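/- Let $K$ be a number field with ring of integers $\mathcal O_K$, let $S$ be a finite set of nonzero prime ideals of $\mathcal O_K$, and let $\mathcal O_{K,S}=\{x\in K: v_{\mathfrak p}(x)\ge 0 \text{ for all } \mathfrak p\notin S\}$ be the ring of $S$-integers. Write $\mathrm N\mathfrak p=|\mathcal O_K/\mathfrak p|$. Let $f$ be a function from the nonzero prime ideals $\mathfrak p\notin S$ to the positive integers such that, for some real constants $c>0$ and $\delta>0$, \[ f(\mathfrak p)=c\,\mathrm N\mathfrak p+O\bigl((\mathrm N\mathfrak p)^{1-\delta}\bigr)\qquad(\mathfrak p\notin S). \] For $n\ge 0$ let $n!_{K,f}$ be the ideal of $\mathcal O_{K,S}$ with \[ v_{\mathfrak p}(n!_{K,f})=\sum_{k\ge 0}\left\lfloor\frac{n}{f(\mathfrak p)\,\mathrm N\mathfrak p^{k}}\right\rfloor\qquad(\mathfrak p\notin S), \] and for $n\ge 1$ put $B_{K,f,S}(n)=\log\bigl(n!_{K,f}/(n-1)!_{K,f}\bigr)$, where the logarithm of a fractional ideal means the logarithm of its absolute norm. Let \[ D_{K,f,S}(s)=\sum_{n\ge 1}\frac{B_{K,f,S}(n)}{n^{s}}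 . \] Then this series converges absolutely for $\Re(s)>1$, and $D_{K,f,S}$ has a meromorphic continuation to a neighbourhood of $s=1$ (again denoted $D_{K,f,S}$), with a pole of order exactly $2$ at $s=1$. More precisely, there is a real constant $A_{K,f,S}$ such that \[ D_{K,f,S}(s)=\frac{1/c}{(s-1)^2}+\frac{A_{K,f,S}}{s-1}+O(1)\qquad(s\to 1), \] and, for every real $x>0$, \[ \operatorname{Res}_{s=1}\left(D_{K,f,S}(s)\,\frac{x^{s}}{s}\right)=\frac1c\,x\log x+\left(A_{K,f,S}-\frac1c\right)x . \] -/

import Mathlib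

open Filter Topology Asymptotics
open NumberField IsDedekindDomain

noncomputable section

namespace LegendreFactorial

variable {K : Type*} [Field K] [NumberField K]

/-- The nonzero prime ideals of `𝓞 K` outside the finite set `S`. -/
abbrev PrimesOutside (S : Finset (HeightOneSpectrum (𝓞 K))) : Type _ :=
  {p : HeightOneSpectrum (𝓞 K) // p ∉ S}

/-- The ring of `S`-integers of `K`: the elements `x` of `K` with `v_p(x) ≥ 0` for all `p ∉ S`. -/
abbrev SIntegers (S : Finset (HeightOneSpectrum (𝓞 K))) : Subalgebra (𝓞 K) K :=
  Set.integer (S : Set (HeightOneSpectrum (𝓞 K))) K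

/-- The absolute norm `N p = |𝓞 K / p|`. -/
def primeNorm (p : HeightOneSpectrum (𝓞 K)) : ℕ :=
  Ideal.absNorm p.asIdeal

variable {S : Finset (HeightOneSpectrum (𝓞 K))}

/-- The exponent `v_p(n!) = ∑_{k ≥ 0} ⌊n / (f(p) (N p) ^ k)⌋`
(`/` is division with floor on `ℕ`; only finitely many terms are nonzero because `N p ≥ 2`). -/
def factorialVal (f : PrimesOutside S → ℕ+) (n : ℕ) (p : PrimesOutside S) : ℕ :=
  ∑ᶠ k : ℕ, n / ((f p : ℕ) * primeNorm p.1 ^ k)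

/-- The generalized factorial `n!`: the ideal of the ring of `S`-integers with `v_p`-adic valuation
`factorialVal f n p` at each prime `p ∉ S`. The primes of the ring of `S`-integers are the
extensions of the primes `p ∉ S`. If `f p` tends to infinity with `N p`, then all but finitely many
exponents vanish. -/
def factorialIdeal (f : PrimesOutside S → ℕ+) (n : ℕ) : Ideal (SIntegers S) :=
  ∏ᶠ p : PrimesOutside S,
    (p.1.asIdeal.map (algebraMap (𝓞 K) (SIntegers S))) ^ factorialVal f n p

/-- The absolute norm of an ideal of the ring of `S`-integers: the number of residue classes. -/
def idealNorm (I : Ideal (SIntegers S)) : ℕ :=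
  Nat.card (SIntegers S ⧸ I)

/-- The increment `B(n) = log (n! / (n-1)!)`, where the logarithm of a (fractional) ideal is the
logarithm of its absolute norm. -/
def increment (f : PrimesOutside S → ℕ+) (n : ℕ) : ℝ :=
  Real.log ((idealNorm (factorialIdeal f n) : ℝ) / (idealNorm (factorialIdeal f (n - 1)) : ℝ))

/-- The coefficients `B(n)` of the Dirichlet series, as complex numbers. -/
def coeff (f : PrimesOutside S → ℕ+) (n : ℕ) : ℂ :=
  (increment f n : ℂ)

/-- The Dirichlet series `D(s) = ∑_{n ≥ 1} B(n) / n ^ s`. -/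
def dirichletSeries (f : PrimesOutside S → ℕ+) (s : ℂ) : ℂ :=
  LSeries (coeff f) s

/-- `F` continues `D`, given on the half-plane `Re s > 1`, meromorphically to a neighbourhood
of `s = 1`. Two such `F` agree on a punctured neighbourhood of `1`, by the identity theorem. -/
structure IsMeromorphicContinuationAtOne (D F : ℂ → ℂ) : Prop where
  meromorphicAt : MeromorphicAt F 1
  eq_of_one_lt_re : ∀ s : ℂ, 1 < s.re → F s = D s

/-- `r` is the residue of `g` at `z`: on every sufficiently small circle about `z` the
function `g` is integrable, and `(2 π i)⁻¹ ∮ g = r`. -/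
def HasResidueAt (g : ℂ → ℂ) (z r : ℂ) : Prop :=
  ∀ᶠ ε : ℝ in 𝓝[>] 0, CircleIntegrable g z ε ∧
    (2 * (Real.pi : ℂ) * Complex.I)⁻¹ * (∮ w in C(z, ε), g w) = r

end LegendreFactorial

end

/-! Since `⌊n/d⌋ - ⌊(n-1)/d⌋` is 1 or 0 according as `d` divides `n` or not, `B(n)` is the sum of
`log Np` over the pairs `(p, k)` with `f(p) Np^k ∣ n` (`hasSum_increment`). So the coefficients are
a Dirichlet convolution with the constant function 1, and for `Re s > 1` `D(s) = ζ(s) · ∑_p log Np ·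
f(p)^(-s) / (1 - Np^(-s))` (`dirichletSeries_eq`). Replacing `f(p)` by `c Np` changes the sum over
`p` by a series dominated by `log Np · Np^(-σ-δ)`, which is analytic near 1
(`analyticAt_tsum_comparisonTerm`). What remains is `c^(-s)` times `-ζ_K'/ζ_K`, up to finitely many
terms from `S`. Both `ζ` and `-ζ_K'/ζ_K` have a simple pole with residue 1, so `(s-1)^2 D(s)`
extends analytically with value `1/c` at 1 (`exists_analyticAt_dirichletSeries`). The Laurent
expansion and the residues follow, and `A` is real because `D` is real on the real axis
(`polar_part_of_double_pole`).

The analytic input is that `(s-1) ζ_K(s)` extends analytically across 1. Each ideal class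
contributes a sum over a lattice `L` of rank `d = [K:ℚ]` in the mixed space, in which multiplication
by units has to be divided out. Instead of a fundamental cone, a continuous weight is used: a
product of tent functions in the logarithmic coordinates, whose translates by units form a partition
of unity (`hasSum_coneWeight_unit_smul`). The summand `Φ(x, s) = w(x) N(x)^(-s)` satisfies `Φ(x/2,
s) = 2^(ds) Φ(x, s)`; splitting `L` into the `2^d` cosets of `2L` yields `(2^(ds) - 2^d) ∑_x Φ(x, s)
= ∑_β ∑_x (Φ(x+β, s) - Φ(x, s))` (`exists_differentiableOn_lattice_sum`). The weight is Lipschitz in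
logarithmic coordinates, so near `s = 1` the differences are `O(‖x‖^(-d-1/2))` and the right side is
analytic. The factor on the left has a simple zero at 1, and the class number formula, as a limit
along real `t ↓ 1`, shows that `(s-1) ζ_K(s)` does not vanish there. -/

noncomputable section

/-! ### Double poles: continuation, polar part, residues -/

namespace LegendreFactorial

/-- An analytic function is its first order Taylor polynomial plus an analytic multiple of
`(s - a) ^ 2`. -/
theorem exists_analyticAt_taylor_one {Q : ℂ → ℂ} {a : ℂ} (hQ : AnalyticAt ℂ Q a) :
    ∃ R : ℂ → ℂ, AnalyticAt ℂ R a ∧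
      ∀ s, Q s = Q a + deriv Q a * (s - a) + (s - a) ^ 2 * R s := by
  have key : ∀ {g : ℂ → ℂ}, AnalyticAt ℂ g a → AnalyticAt ℂ (dslope g a) a := by
    intro g hg
    obtain ⟨p, hp⟩ := hg
    exact ⟨_, hp.has_fpower_series_dslope_fslope⟩
  -- The remainder is the second divided difference; its defining identities hold at every `s`, not
  -- only near `a`.
  refine ⟨dslope (dslope Q a) a, key (key hQ), fun s => ?_⟩
  have h1 := sub_smul_dslope Q a s
  have h2 := sub_smul_dslope (dslope Q a) a s
  rw [dslope_same] at h2
  simp only [smul_eq_mul] at h1 h2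
  linear_combination -h1 - (s - a) * h2

/-- Input for the identity theorem: meromorphic functions that agree on the half-plane agree at
points accumulating at 1, hence on a punctured neighbourhood. -/
theorem frequently_one_lt_re : ∃ᶠ s in 𝓝[≠] (1 : ℂ), 1 < s.re := by
  have h : Tendsto (fun t : ℝ => (t : ℂ)) (𝓝[>] 1) (𝓝[≠] (1 : ℂ)) := by
    refine tendsto_nhdsWithin_iff.2 ⟨?_, ?_⟩
    · exact (Complex.continuous_ofReal.tendsto' 1 1 (by simp)).mono_left nhdsWithin_le_nhds
    · filter_upwards [self_mem_nhdsWithin] with t ht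
      simpa using ne_of_gt ht
  refine h.frequently (Eventually.frequently ?_)
  filter_upwards [self_mem_nhdsWithin] with t ht
  simpa using ht

theorem IsMeromorphicContinuationAtOne.eventually_eq {D F Q : ℂ → ℂ} (hQ : AnalyticAt ℂ Q 1)
    (hD : ∀ᶠ s in 𝓝 (1 : ℂ), 1 < s.re → (s - 1) ^ 2 * D s = Q s)
    (hF : IsMeromorphicContinuationAtOne D F) :
    ∀ᶠ s in 𝓝[≠] (1 : ℂ), F s = Q s / (s - 1) ^ 2 := by
  have hm : MeromorphicAt (fun s : ℂ => Q s / (s - 1) ^ 2) 1 :=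
    hQ.meromorphicAt.div (by fun_prop)
  refine (hF.meromorphicAt.frequently_eq_iff_eventuallyEq hm).1 ?_
  refine (frequently_one_lt_re.and_eventually
    ((hD.filter_mono nhdsWithin_le_nhds).and self_mem_nhdsWithin)).mono ?_
  rintro s ⟨hs, h1, h2⟩
  have : (s - 1) ≠ 0 := sub_ne_zero.2 h2
  rw [hF.eq_of_one_lt_re s hs, ← h1 hs]
  field_simp

theorem exists_isMeromorphicContinuationAtOne {D Q : ℂ → ℂ} (hQ : AnalyticAt ℂ Q 1)
    (hD : ∀ᶠ s in 𝓝 (1 : ℂ), 1 < s.re → (s - 1) ^ 2 * D s = Q s) :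
    ∃ F, IsMeromorphicContinuationAtOne D F := by
  classical
  -- A continuation has to equal `D` on the whole half-plane, whereas `Q` describes `D` only near 1;
  -- the two are glued.
  refine ⟨fun s => if 1 < s.re then D s else Q s / (s - 1) ^ 2, ?_, fun s hs => if_pos hs⟩
  have hm : MeromorphicAt (fun s : ℂ => Q s / (s - 1) ^ 2) 1 :=
    hQ.meromorphicAt.div (by fun_prop)
  refine hm.congr ?_
  filter_upwards [hD.filter_mono nhdsWithin_le_nhds, self_mem_nhdsWithin] with s h1 h2
  have : (s - 1) ≠ 0 := sub_ne_zero.2 h2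
  split_ifs with hs
  · rw [← h1 hs]; field_simp
  · rfl

/-- The value and the derivative are limits, along real points from the right, of real values and
real slopes. This makes the coefficient `A` real. -/
theorem im_deriv_eq_zero_of_real {Q : ℂ → ℂ} (hQ : AnalyticAt ℂ Q 1)
    (hr : ∀ᶠ t : ℝ in 𝓝[>] 1, (Q t).im = 0) : (Q 1).im = 0 ∧ (deriv Q 1).im = 0 := by
  have h : Tendsto (fun t : ℝ => (t : ℂ)) (𝓝[>] 1) (𝓝[≠] (1 : ℂ)) := by
    refine tendsto_nhdsWithin_iff.2 ⟨?_, ?_⟩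
    · exact (Complex.continuous_ofReal.tendsto' 1 1 (by simp)).mono_left nhdsWithin_le_nhds
    · filter_upwards [self_mem_nhdsWithin] with t ht
      simpa using ne_of_gt ht
  have h0 : (Q 1).im = 0 := by
    have h1 := (Complex.continuous_im.tendsto _).comp
      (hQ.continuousAt.tendsto.comp (h.mono_right nhdsWithin_le_nhds))
    refine tendsto_nhds_unique h1 (tendsto_const_nhds.congr' ?_)
    filter_upwards [hr] with t ht
    simp [ht]
  refine ⟨h0, ?_⟩
  have h1 := (Complex.continuous_im.tendsto _).comp
    ((hasDerivAt_iff_tendsto_slope.1 hQ.differentiableAt.hasDerivAt).comp h)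
  refine tendsto_nhds_unique h1 (tendsto_const_nhds.congr' ?_)
  filter_upwards [hr] with t ht
  have : slope Q 1 (t : ℂ) = ((t - 1)⁻¹ : ℝ) * (Q t - Q 1) := by
    simp [slope_def_field, div_eq_inv_mul]
  simp only [Function.comp_apply, this, Complex.im_ofReal_mul, Complex.sub_im, ht, h0]
  simp

/-- Cauchy's formula for `φ'` handles the double pole, the one for `φ` the simple pole, and Cauchy's
theorem kills the regular part. -/
theorem hasResidueAt_of_double_pole {F R φ : ℂ → ℂ} {a b z φ' : ℂ}
    (hF : ∀ᶠ s in 𝓝[≠] z, F s = a / (s - z) ^ 2 + b / (s - z) + R s)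
    (hR : AnalyticAt ℂ R z) (hφ : AnalyticAt ℂ φ z) (hφ' : HasDerivAt φ φ' z) :
    HasResidueAt (fun s => F s * φ s) z (a * φ' + b * φ z) := by
  obtain ⟨r, hr, hball⟩ : ∃ r > 0, ∀ s ∈ Metric.ball z r,
      (s ≠ z → F s = a / (s - z) ^ 2 + b / (s - z) + R s) ∧ DifferentiableAt ℂ R s ∧
        DifferentiableAt ℂ φ s := by
    have h1 := hR.eventually_analyticAt
    have h2 := hφ.eventually_analyticAt
    obtain ⟨r, hr, h⟩ := Metric.eventually_nhds_iff_ball.1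
      ((eventually_nhdsWithin_iff.1 hF).and (h1.and h2))
    exact ⟨r, hr, fun s hs => ⟨(h s hs).1, (h s hs).2.1.differentiableAt,
      (h s hs).2.2.differentiableAt⟩⟩
  filter_upwards [Ioo_mem_nhdsGT hr] with ε hε
  have hsub : Metric.closedBall z ε ⊆ Metric.ball z r :=
    Metric.closedBall_subset_ball hε.2
  have hφd : DifferentiableOn ℂ φ (Metric.ball z r) :=
    fun s hs => (hball s hs).2.2.differentiableWithinAt
  have hne : ∀ s ∈ Metric.sphere z ε, s - z ≠ 0 := by
    intro s hs h
    rw [sub_eq_zero.1 h, Metric.mem_sphere, dist_self] at hs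
    exact hε.1.ne hs
  set g1 : ℂ → ℂ := fun s => a * ((s - z) ^ (-2 : ℤ) * φ s) with hg1
  set g2 : ℂ → ℂ := fun s => b * ((s - z)⁻¹ * φ s) with hg2
  set g3 : ℂ → ℂ := fun s => R s * φ s with hg3
  have hss : Metric.sphere z ε ⊆ Metric.ball z r := Metric.sphere_subset_closedBall.trans hsub
  have hφc : ContinuousOn φ (Metric.sphere z ε) := hφd.continuousOn.mono hss
  have hc1 : ContinuousOn g1 (Metric.sphere z ε) := by
    refine continuousOn_const.mul (ContinuousOn.mul ?_ hφc)
    exact ContinuousOn.zpow₀ (by fun_prop) _ (fun s hs => Or.inl (hne s hs))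
  have hc2 : ContinuousOn g2 (Metric.sphere z ε) :=
    continuousOn_const.mul ((ContinuousOn.inv₀ (by fun_prop) hne).mul hφc)
  have hg3d : DifferentiableOn ℂ g3 (Metric.closedBall z ε) := fun s hs =>
    ((hball s (hsub hs)).2.1.mul (hball s (hsub hs)).2.2).differentiableWithinAt
  have hc3 : ContinuousOn g3 (Metric.sphere z ε) :=
    hg3d.continuousOn.mono Metric.sphere_subset_closedBall
  have hi1 := hc1.circleIntegrable hε.1.le
  have hi2 := hc2.circleIntegrable hε.1.le
  have hi3 := hc3.circleIntegrable hε.1.le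
  have heq : Set.EqOn (fun s => F s * φ s) (fun s => g1 s + g2 s + g3 s)
      (Metric.sphere z ε) := by
    intro s hs
    have h0 := hne s hs
    have := (hball s (hss hs)).1 (sub_ne_zero.1 h0)
    simp only [this, hg1, hg2, hg3, zpow_neg]
    norm_cast
    field_simp
  refine ⟨?_, ?_⟩
  · refine ContinuousOn.circleIntegrable hε.1.le ?_
    exact ((hc1.add hc2).add hc3).congr heq
  · rw [circleIntegral.integral_congr hε.1.le heq,
      circleIntegral.integral_add (f := fun s => g1 s + g2 s) (hi1.add hi2) hi3,
      circleIntegral.integral_add hi1 hi2]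
    have e3 : (∮ s in C(z, ε), g3 s) = 0 := by
      refine Complex.circleIntegral_eq_zero_of_differentiable_on_off_countable hε.1.le
        Set.countable_empty hg3d.continuousOn ?_
      intro s hs
      have hs' := hsub (Metric.ball_subset_closedBall hs.1)
      exact (hball s hs').2.1.mul (hball s hs').2.2
    have hzb : z ∈ Metric.ball z ε := Metric.mem_ball_self hε.1
    have e2 : (∮ s in C(z, ε), g2 s) = b * ((2 * Real.pi * Complex.I) * φ z) := by
      simp only [hg2]
      rw [circleIntegral.integral_const_mul]
      have := (hφd.mono hsub).circleIntegral_sub_inv_smul hzb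
      simp only [smul_eq_mul] at this
      rw [this]
    have e1 : (∮ s in C(z, ε), g1 s) = a * ((2 * Real.pi * Complex.I) * φ') := by
      simp only [hg1]
      rw [circleIntegral.integral_const_mul]
      have := Complex.two_pi_I_inv_smul_circleIntegral_sub_sq_inv_smul_of_differentiable
        (U := Metric.ball z r) Metric.isOpen_ball hsub hφd hzb
      rw [hφ'.deriv] at this
      rw [← this]
      simp only [smul_eq_mul]
      rw [mul_inv_cancel_left₀ Complex.two_pi_I_ne_zero]
      congr 1
    rw [e1, e2, e3]
    field_simp [Complex.two_pi_I_ne_zero]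
    ring

/-- If `(s - 1) ^ 2 D(s)` extends to an analytic function `Q` near `1` with `Q 1 = 1 / c`, then
any meromorphic continuation of `D` has the expected polar part at `1`. -/
theorem polar_part_of_double_pole {D Q : ℂ → ℂ} {c : ℝ} (hc : 0 < c) (hQ : AnalyticAt ℂ Q 1)
    (hQ1 : Q 1 = 1 / c)
    (hD : ∀ᶠ s in 𝓝 (1 : ℂ), 1 < s.re → (s - 1) ^ 2 * D s = Q s)
    (hreal : ∀ t : ℝ, 1 < t → (D t).im = 0) :
    ∃ A : ℝ, ∀ F : ℂ → ℂ, IsMeromorphicContinuationAtOne D F →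
      meromorphicOrderAt F 1 = ((-2 : ℤ) : WithTop ℤ) ∧
      (fun s : ℂ => F s - ((1 / (c : ℂ)) / (s - 1) ^ 2 + (A : ℂ) / (s - 1)))
        =O[𝓝[≠] (1 : ℂ)] (fun _ : ℂ => (1 : ℝ)) ∧
      ∀ x : ℝ, 0 < x →
        HasResidueAt (fun s : ℂ => F s * ((x : ℂ) ^ s / s)) 1
          (((1 / c) * (x * Real.log x) + (A - 1 / c) * x : ℝ) : ℂ) := by
  obtain ⟨R, hR, hQR⟩ := exists_analyticAt_taylor_one hQ
  have him : (deriv Q 1).im = 0 := by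
    refine (im_deriv_eq_zero_of_real hQ ?_).2
    have h : Tendsto (fun t : ℝ => (t : ℂ)) (𝓝[>] 1) (𝓝 (1 : ℂ)) :=
      (Complex.continuous_ofReal.tendsto' 1 1 (by simp)).mono_left nhdsWithin_le_nhds
    filter_upwards [h.eventually hD, self_mem_nhdsWithin] with t ht h1
    rw [← ht (by simpa using h1)]
    have : ((t : ℂ) - 1) ^ 2 = (((t - 1) ^ 2 : ℝ) : ℂ) := by push_cast; ring
    rw [this, Complex.im_ofReal_mul, hreal t h1, mul_zero]
  have hA : ((deriv Q 1).re : ℂ) = deriv Q 1 := Complex.ext (by simp) (by simp [him])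
  have hc' : (c : ℂ) ≠ 0 := by exact_mod_cast hc.ne'
  refine ⟨(deriv Q 1).re, fun F hF => ?_⟩
  have hFQ := hF.eventually_eq hQ hD
  have hFR : ∀ᶠ s in 𝓝[≠] (1 : ℂ),
      F s = (1 / (c : ℂ)) / (s - 1) ^ 2 + ((deriv Q 1).re : ℂ) / (s - 1) + R s := by
    filter_upwards [hFQ, self_mem_nhdsWithin] with s h1 h2
    have : (s - 1) ≠ 0 := sub_ne_zero.2 h2
    rw [h1, hA, hQR s, hQ1]
    field_simp
  refine ⟨?_, ?_, ?_⟩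
  · rw [meromorphicOrderAt_eq_int_iff hF.meromorphicAt]
    refine ⟨Q, hQ, by rw [hQ1]; simp [hc'], ?_⟩
    filter_upwards [hFQ] with s h1
    rw [h1, zpow_neg, smul_eq_mul, div_eq_inv_mul]
    norm_cast
  · have : (fun s : ℂ => F s - ((1 / (c : ℂ)) / (s - 1) ^ 2 + ((deriv Q 1).re : ℂ) / (s - 1)))
        =ᶠ[𝓝[≠] (1 : ℂ)] R := by
      filter_upwards [hFR] with s h1
      rw [h1]; ring
    refine this.trans_isBigO ?_
    exact (hR.continuousAt.tendsto.isBigO_one ℝ).mono nhdsWithin_le_nhds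
  · intro x hx
    have hx' : (x : ℂ) ≠ 0 := by exact_mod_cast hx.ne'
    -- The derivative at 1 is `x log x - x`. Paired with the coefficients `1/c` and `A` it yields
    -- `(1/c)(x log x - x) + A x`.
    have hd : HasDerivAt (fun s : ℂ => (x : ℂ) ^ s / s)
        (((x : ℂ) ^ (1 : ℂ) * Complex.log x * 1 * 1 - (x : ℂ) ^ (1 : ℂ) * 1) / 1 ^ 2) 1 := by
      have h1 := (hasDerivAt_id (1 : ℂ)).const_cpow (c := (x : ℂ)) (Or.inl hx')
      exact h1.div (hasDerivAt_id (1 : ℂ)) one_ne_zero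
    have han : AnalyticAt ℂ (fun s : ℂ => (x : ℂ) ^ s / s) 1 := by
      refine AnalyticAt.div ?_ analyticAt_id one_ne_zero
      refine DifferentiableOn.analyticAt (s := Set.univ) ?_ univ_mem
      intro s _
      exact ((hasDerivAt_id s).const_cpow (Or.inl hx')).differentiableAt.differentiableWithinAt
    convert hasResidueAt_of_double_pole hFR hR han hd using 1
    simp only [Complex.cpow_one, ← Complex.ofReal_log hx.le]
    push_cast
    ring

end LegendreFactorial

end

/-! ### Dirichlet convolution over a cancellative monoid -/

noncomputable section

namespace LegendreFactorial

/-- A sum over `M` weighted by the divisors `d b` of the summation index factors as a product. -/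
theorem hasSum_divisor_weights {M B : Type*} [CommMonoid M] [IsCancelMul M] (χ : M →* ℂ) (d : B → M)
    (L : B → ℂ) (hχ : Summable fun m => ‖χ m‖) (hL : Summable fun b => ‖L b * χ (d b)‖)
    (W : M → ℂ) (hW : ∀ m, HasSum (fun b => by classical exact if d b ∣ m then L b else 0) (W m)) :
    (Summable fun m => ‖W m * χ m‖) ∧
      HasSum (fun m => W m * χ m) ((∑' b, L b * χ (d b)) * ∑' m, χ m) := by
  classical
  let G : M × B → ℂ := fun p => if d p.2 ∣ p.1 then L p.2 * χ p.1 else 0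
  -- The pairs `(m, b)` with `d b ∣ m` are the image of this map, injective by cancellation. On that
  -- image the summand separates into a function of `b` times a function of the cofactor.
  let i : B × M → M × B := fun p => (d p.1 * p.2, p.1)
  have hi : Function.Injective i := by
    rintro ⟨b, m⟩ ⟨b', m'⟩ h
    simp only [i, Prod.mk.injEq] at h
    obtain ⟨h, rfl⟩ := h
    simpa using h
  have hGi : ∀ p, G (i p) = (L p.1 * χ (d p.1)) * χ p.2 := by
    rintro ⟨b, m⟩
    simp [G, i, mul_assoc]
  have hoff : ∀ p, p ∉ Set.range i → G p = 0 := by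
    rintro ⟨m, b⟩ hp
    refine if_neg fun ⟨m', hm'⟩ => hp ⟨(b, m'), ?_⟩
    simp only at hm'
    simp [i, hm']
  have hsum : HasSum G ((∑' b, L b * χ (d b)) * ∑' m, χ m) := by
    rw [← hi.hasSum_iff hoff]
    have h0 : Summable fun p : B × M => (L p.1 * χ (d p.1)) * χ p.2 :=
      summable_mul_of_summable_norm (f := fun b => L b * χ (d b)) (g := fun m => χ m) hL hχ
    have h1 := HasSum.mul (f := fun b => L b * χ (d b)) (g := fun m => χ m)
      hL.of_norm.hasSum hχ.of_norm.hasSum h0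
    rwa [← show G ∘ i = fun p : B × M => (L p.1 * χ (d p.1)) * χ p.2 from funext hGi] at h1
  have hnorm : Summable fun p => ‖G p‖ := by
    have hoff' : ∀ p, p ∉ Set.range i → ‖G p‖ = 0 := fun p hp => by rw [hoff p hp, norm_zero]
    rw [← hi.summable_iff hoff']
    refine (Summable.mul_norm (f := fun b => L b * χ (d b)) (g := fun m => χ m)
      hL hχ).congr fun p => ?_
    simp [hGi]
  have hfib : ∀ m, HasSum (fun b => G (m, b)) (W m * χ m) := by
    intro m
    have h1 := (hW m).mul_right (χ m)
    have h2 : (fun b => G (m, b)) = fun b => (if d b ∣ m then L b else 0) * χ m := by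
      funext b
      simp only [G]
      split_ifs <;> simp
    rwa [h2]
  refine ⟨?_, hsum.prod_fiberwise hfib⟩
  refine Summable.of_nonneg_of_le (fun _ => norm_nonneg _) (fun m => ?_) hnorm.prod
  rw [← (hfib m).tsum_eq]
  exact norm_tsum_le_tsum_norm (hnorm.prod_factor m)

end LegendreFactorial

end

/-! ### Norms of ideals of the `S`-integers -/

noncomputable section

namespace LegendreFactorial

variable {K : Type*} [Field K] [NumberField K] {S : Finset (HeightOneSpectrum (𝓞 K))}

/-- The denominators of `x` form an ideal contained in no prime above `I`, because `x` is integral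
at the primes outside `S`. That ideal is therefore comaximal with `I` and contains some `a ≡ 1` mod
`I`. -/
theorem SIntegers.exists_denominator {I : Ideal (𝓞 K)} (hI0 : I ≠ ⊥)
    (hI : ∀ p : HeightOneSpectrum (𝓞 K), I ≤ p.asIdeal → p ∉ S) (x : SIntegers S) :
    ∃ a : 𝓞 K, a - 1 ∈ I ∧ ∃ b : 𝓞 K,
      algebraMap (𝓞 K) (SIntegers S) a * x = algebraMap (𝓞 K) (SIntegers S) b := by
  let D : Ideal (𝓞 K) :=
    { carrier := {a | ∃ b : 𝓞 K,
        algebraMap (𝓞 K) (SIntegers S) a * x = algebraMap (𝓞 K) (SIntegers S) b}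
      add_mem' := by
        rintro a a' ⟨b, hb⟩ ⟨b', hb'⟩
        exact ⟨b + b', by rw [map_add, map_add, add_mul, hb, hb']⟩
      zero_mem' := ⟨0, by simp⟩
      smul_mem' := by
        rintro c a ⟨b, hb⟩
        exact ⟨c * b, by rw [smul_eq_mul, map_mul, map_mul, mul_assoc, hb]⟩ }
  have htop : D ⊔ I = ⊤ := by
    by_contra h
    obtain ⟨m, hm, hle⟩ := Ideal.exists_le_maximal _ h
    have hmI : I ≤ m := le_sup_right.trans hle
    let p : HeightOneSpectrum (𝓞 K) :=
      ⟨m, hm.isPrime, fun h0 => hI0 (le_bot_iff.1 (h0 ▸ hmI))⟩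
    obtain ⟨n, d, hd⟩ := p.exists_primeCompl_mul_eq_of_integer (x : K)
      (Set.integer_valuation_le_one (S : Set (HeightOneSpectrum (𝓞 K))) K x
        (by simpa using hI p hmI))
    refine d.2 (hle (Ideal.mem_sup_left ⟨n, Subtype.ext ?_⟩))
    rw [mul_comm]
    exact hd
  obtain ⟨a, ⟨b, hb⟩, i, hi, hai⟩ := Submodule.mem_sup.1 ((Ideal.eq_top_iff_one _).1 htop)
  refine ⟨a, ?_, b, hb⟩
  rw [← hai]
  simpa using hi

/-- The norm of an ideal of `𝓞 K` prime to `S` does not change on extension to the `S`-integers. -/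
theorem idealNorm_map {I : Ideal (𝓞 K)} (hI0 : I ≠ ⊥)
    (hI : ∀ p : HeightOneSpectrum (𝓞 K), I ≤ p.asIdeal → p ∉ S) :
    idealNorm (I.map (algebraMap (𝓞 K) (SIntegers S))) = Ideal.absNorm I := by
  have hinj : Function.Injective (algebraMap (𝓞 K) (SIntegers S)) := by
    intro a b h
    exact RingOfIntegers.coe_injective (congrArg (fun x : SIntegers S => (x : K)) h)
  -- Elements of the extended ideal fall back into `I` after multiplication by some `a ≡ 1` mod `I`.
  -- Hence an integral `y` in it satisfies `y = a y - (a - 1) y ∈ I`, so the extension contracts to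
  -- `I`.
  have hmap : ∀ z ∈ I.map (algebraMap (𝓞 K) (SIntegers S)), ∃ a : 𝓞 K, a - 1 ∈ I ∧
      ∃ b ∈ I, algebraMap (𝓞 K) (SIntegers S) a * z = algebraMap (𝓞 K) (SIntegers S) b := by
    intro z hz
    refine Submodule.span_induction (p := fun z _ => ∃ a : 𝓞 K, a - 1 ∈ I ∧
      ∃ b ∈ I, algebraMap (𝓞 K) (SIntegers S) a * z = algebraMap (𝓞 K) (SIntegers S) b)
      ?_ ?_ ?_ ?_ hz
    · rintro _ ⟨b, hb, rfl⟩
      exact ⟨1, by simp, b, hb, by simp⟩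
    · exact ⟨1, by simp, 0, by simp, by simp⟩
    · rintro x y _ _ ⟨a, ha, b, hb, h⟩ ⟨a', ha', b', hb', h'⟩
      refine ⟨a * a', ?_, a' * b + a * b', I.add_mem (I.mul_mem_left _ hb) (I.mul_mem_left _ hb'),
        ?_⟩
      · have : a * a' - 1 = a * (a' - 1) + (a - 1) := by ring
        rw [this]
        exact I.add_mem (I.mul_mem_left _ ha') ha
      · simp only [map_mul, map_add, ← h, ← h']
        ring
    · rintro y x _ ⟨a, ha, b, hb, h⟩
      obtain ⟨a', ha', b', h'⟩ := SIntegers.exists_denominator hI0 hI y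
      refine ⟨a * a', ?_, b' * b, I.mul_mem_left _ hb, ?_⟩
      · have : a * a' - 1 = a * (a' - 1) + (a - 1) := by ring
        rw [this]
        exact I.add_mem (I.mul_mem_left _ ha') ha
      · simp only [map_mul, smul_eq_mul, ← h, ← h']
        ring
  let φ : 𝓞 K →+* SIntegers S ⧸ I.map (algebraMap (𝓞 K) (SIntegers S)) :=
    (Ideal.Quotient.mk _).comp (algebraMap (𝓞 K) (SIntegers S))
  have hker : RingHom.ker φ = I := by
    ext y
    rw [RingHom.mem_ker]
    change Ideal.Quotient.mk _ (algebraMap (𝓞 K) (SIntegers S) y) = 0 ↔ _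
    rw [Ideal.Quotient.eq_zero_iff_mem]
    refine ⟨fun hy => ?_, fun hy => Ideal.mem_map_of_mem _ hy⟩
    obtain ⟨a, ha, b, hb, h⟩ := hmap _ hy
    rw [← map_mul] at h
    have h2 := hinj h
    have : y = a * y - (a - 1) * y := by ring
    rw [this, h2]
    exact I.sub_mem hb (I.mul_mem_right _ ha)
  have hsurj : Function.Surjective φ := by
    intro q
    obtain ⟨x, rfl⟩ := Ideal.Quotient.mk_surjective q
    obtain ⟨a, ha, b, hb⟩ := SIntegers.exists_denominator hI0 hI x
    refine ⟨b, ?_⟩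
    change Ideal.Quotient.mk _ (algebraMap (𝓞 K) (SIntegers S) b) = _
    rw [← hb, Ideal.Quotient.eq]
    have : algebraMap (𝓞 K) (SIntegers S) a * x - x =
        x * algebraMap (𝓞 K) (SIntegers S) (a - 1) := by
      rw [map_sub, map_one]; ring
    rw [this]
    exact Ideal.mul_mem_left _ _ (Ideal.mem_map_of_mem _ ha)
  have e := (Ideal.quotEquivOfEq hker.symm).trans (RingHom.quotientKerEquivOfSurjective hsurj)
  rw [idealNorm, Ideal.absNorm_apply, Submodule.cardQuot_apply]
  exact (Nat.card_congr e.toEquiv).symm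

theorem two_le_primeNorm (p : HeightOneSpectrum (𝓞 K)) : 2 ≤ primeNorm p := by
  have h0 : primeNorm p ≠ 0 := by
    simpa [primeNorm, Ideal.absNorm_eq_zero_iff] using p.ne_bot
  have h1 : primeNorm p ≠ 1 := by
    simpa [primeNorm, Ideal.absNorm_eq_one_iff] using p.isPrime.ne_top
  omega

theorem finite_setOf_primeNorm_le (n : ℕ) : {p : HeightOneSpectrum (𝓞 K) | primeNorm p ≤ n}.Finite := by
  refine ((Ideal.finite_setOfPred_absNorm_le (S := 𝓞 K) n).preimage
    (f := fun p : HeightOneSpectrum (𝓞 K) => p.asIdeal) ?_)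
  intro p _ q _ h
  exact HeightOneSpectrum.ext h

/-- The norm of a product of prime powers outside `S`. -/
theorem idealNorm_finprod {e : PrimesOutside S → ℕ} (he : (Function.support e).Finite) :
    idealNorm (∏ᶠ p : PrimesOutside S,
      (p.1.asIdeal.map (algebraMap (𝓞 K) (SIntegers S))) ^ e p) =
      ∏ p ∈ he.toFinset, primeNorm p.1 ^ e p := by
  have hsub : (Function.mulSupport fun p : PrimesOutside S =>
      (p.1.asIdeal.map (algebraMap (𝓞 K) (SIntegers S))) ^ e p) ⊆ he.toFinset := by
    intro p hp
    rw [Function.mem_mulSupport] at hp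
    simp only [Set.Finite.coe_toFinset, Function.mem_support]
    intro h
    exact hp (by rw [h, pow_zero])
  rw [finprod_eq_prod_of_mulSupport_subset _ hsub]
  have hmap : ∏ p ∈ he.toFinset, (p.1.asIdeal.map (algebraMap (𝓞 K) (SIntegers S))) ^ e p =
      (∏ p ∈ he.toFinset, p.1.asIdeal ^ e p).map (algebraMap (𝓞 K) (SIntegers S)) := by
    simp_rw [← Ideal.map_pow]
    exact (map_prod (Ideal.mapHom (algebraMap (𝓞 K) (SIntegers S))) _ _).symm
  rw [hmap, idealNorm_map]
  · rw [map_prod]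
    simp [primeNorm]
  · rw [← Ideal.zero_eq_bot, Finset.prod_ne_zero_iff]
    exact fun p _ => pow_ne_zero _ p.1.ne_bot
  · intro q hq
    obtain ⟨p, -, hp⟩ := (q.isPrime.prod_le (s := he.toFinset)).1 hq
    have h1 : p.1.asIdeal ≤ q.asIdeal := q.isPrime.le_of_pow_le hp
    have h2 : p.1 = q := HeightOneSpectrum.ext (p.1.isMaximal.eq_of_le q.isPrime.ne_top h1)
    exact h2 ▸ p.2

end LegendreFactorial

end

/-! ### The increments and the factorization of the Dirichlet series -/

noncomputable section

namespace LegendreFactorial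

variable {K : Type*} [Field K] [NumberField K] {S : Finset (HeightOneSpectrum (𝓞 K))}

/-- Tonelli's theorem: for nonnegative terms, iterated summation already gives summability over the
product. -/
theorem hasSum_prod_of_nonneg {A B : Type*} {f : A × B → ℝ} {g : A → ℝ} {s : ℝ}
    (hf : ∀ x, 0 ≤ f x) (h1 : ∀ a, HasSum (fun b => f (a, b)) (g a)) (h2 : HasSum g s) :
    HasSum f s := by
  have hs : Summable f := by
    rw [summable_prod_of_nonneg hf]
    exact ⟨fun a => (h1 a).summable, by simpa only [(h1 _).tsum_eq] using h2.summable⟩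
  have := hs.hasSum.prod_fiberwise h1
  rw [← this.unique h2]
  exact hs.hasSum

variable (f : PrimesOutside S → ℕ+)

theorem one_le_mul_primeNorm_pow (p : PrimesOutside S) (k : ℕ) :
    1 ≤ (f p : ℕ) * primeNorm p.1 ^ k := by
  have := two_le_primeNorm p.1
  exact Nat.succ_le_of_lt (Nat.mul_pos (f p).pos (pow_pos (by omega) _))

theorem finite_support_div (n : ℕ) (p : PrimesOutside S) :
    (Function.support fun k : ℕ => n / ((f p : ℕ) * primeNorm p.1 ^ k)).Finite := by
  refine (Set.finite_Iio n).subset fun k hk => ?_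
  by_contra hkn
  refine hk (Nat.div_eq_of_lt ?_)
  have h1 : k < primeNorm p.1 ^ k :=
    (Nat.lt_two_pow_self).trans_le (Nat.pow_le_pow_left (two_le_primeNorm p.1) k)
  have h2 := Nat.le_mul_of_pos_left (primeNorm p.1 ^ k) (f p).pos
  simp only [Set.mem_Iio, not_lt] at hkn
  omega

theorem hasSum_factorialVal (n : ℕ) (p : PrimesOutside S) :
    HasSum (fun k : ℕ => ((n / ((f p : ℕ) * primeNorm p.1 ^ k) : ℕ) : ℝ))
      (factorialVal f n p : ℝ) := by
  have h := finite_support_div f n p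
  rw [factorialVal, finsum_eq_sum _ h, Nat.cast_sum]
  refine hasSum_sum_of_ne_finset_zero fun k hk => ?_
  have : n / ((f p : ℕ) * primeNorm p.1 ^ k) = 0 := by
    rwa [Set.Finite.mem_toFinset, Function.notMem_support] at hk
  simp [this]

/-- Passing from `n` to `n + 1` raises `⌊n/d⌋` by one exactly when `d ∣ n + 1`. -/
theorem hasSum_factorialVal_succ_sub (n : ℕ) (p : PrimesOutside S) :
    HasSum (fun k : ℕ => if (f p : ℕ) * primeNorm p.1 ^ k ∣ n + 1 then (1 : ℝ) else 0)
      ((factorialVal f (n + 1) p : ℝ) - factorialVal f n p) := by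
  have h := (hasSum_factorialVal f (n + 1) p).sub (hasSum_factorialVal f n p)
  refine (funext fun k => ?_ : (fun k : ℕ => _) = _) ▸ h
  rw [Nat.succ_div]
  push_cast
  ring

theorem factorialVal_eq_zero {n : ℕ} {p : PrimesOutside S} (h : n < f p) :
    factorialVal f n p = 0 := by
  refine finsum_eq_zero_of_forall_eq_zero fun k => Nat.div_eq_of_lt (h.trans_le ?_)
  exact Nat.le_mul_of_pos_right _ (pow_pos (by have := two_le_primeNorm p.1; omega) _)

/-- Ensures that the `∏ᶠ` in `factorialIdeal` is a genuine finite product and not the default value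
1. -/
theorem finite_support_factorialVal (hfin : ∀ n : ℕ, {p | (f p : ℕ) ≤ n}.Finite) (n : ℕ) :
    (Function.support (factorialVal f n)).Finite := by
  refine (hfin n).subset fun p hp => ?_
  by_contra h
  exact hp (factorialVal_eq_zero f (not_le.1 h))

theorem hasSum_log_idealNorm_factorialIdeal (hfin : ∀ n : ℕ, {p | (f p : ℕ) ≤ n}.Finite) (n : ℕ) :
    HasSum (fun p => (factorialVal f n p : ℝ) * Real.log (primeNorm p.1))
      (Real.log (idealNorm (factorialIdeal f n))) := by
  have h := finite_support_factorialVal f hfin n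
  rw [factorialIdeal, idealNorm_finprod h]
  push_cast
  rw [Real.log_prod fun p _ => pow_ne_zero _
    (by have := two_le_primeNorm p.1; exact_mod_cast (by omega : primeNorm p.1 ≠ 0))]
  simp_rw [Real.log_pow]
  refine hasSum_sum_of_ne_finset_zero fun p hp => ?_
  have : factorialVal f n p = 0 := by simpa using hp
  simp [this]

theorem idealNorm_factorialIdeal_ne_zero (hfin : ∀ n : ℕ, {p | (f p : ℕ) ≤ n}.Finite) (n : ℕ) :
    idealNorm (factorialIdeal f n) ≠ 0 := by
  rw [factorialIdeal, idealNorm_finprod (finite_support_factorialVal f hfin n),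
    Finset.prod_ne_zero_iff]
  exact fun p _ => pow_ne_zero _ (by have := two_le_primeNorm p.1; omega)

/-- The analogue of `log n = ∑_{d ∣ n} Λ(d)`: it exhibits the coefficients as sums of divisor
weights, the form needed by `hasSum_divisor_weights`. -/
theorem hasSum_increment (hfin : ∀ n : ℕ, {p | (f p : ℕ) ≤ n}.Finite) {n : ℕ} (hn : n ≠ 0) :
    HasSum (fun b : PrimesOutside S × ℕ => if (f b.1 : ℕ) * primeNorm b.1.1 ^ b.2 ∣ n then
      Real.log (primeNorm b.1.1) else 0) (increment f n) := by
  obtain ⟨n, rfl⟩ := Nat.exists_eq_succ_of_ne_zero hn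
  have hlog : ∀ p : PrimesOutside S, 0 ≤ Real.log (primeNorm p.1) := fun p =>
    Real.log_natCast_nonneg _
  refine hasSum_prod_of_nonneg (g := fun p => ((factorialVal f (n + 1) p : ℝ) -
    factorialVal f n p) * Real.log (primeNorm p.1)) ?_ ?_ ?_
  · rintro ⟨p, k⟩
    dsimp only
    split_ifs
    exacts [hlog p, le_rfl]
  · intro p
    simpa only [ite_mul, one_mul, zero_mul] using
      (hasSum_factorialVal_succ_sub f n p).mul_right (Real.log (primeNorm p.1))
  · have := (hasSum_log_idealNorm_factorialIdeal f hfin (n + 1)).sub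
      (hasSum_log_idealNorm_factorialIdeal f hfin n)
    rw [increment, Nat.succ_sub_one, Real.log_div
      (by exact_mod_cast idealNorm_factorialIdeal_ne_zero f hfin _)
      (by exact_mod_cast idealNorm_factorialIdeal_ne_zero f hfin _)]
    simpa only [sub_mul] using this

/-- The character `n ↦ n ^ (-s)` of the multiplicative monoid of positive integers. -/
def pnatCpow (s : ℂ) : ℕ+ →* ℂ where
  toFun n := (n : ℂ) ^ (-s)
  map_one' := by simp
  map_mul' m n := by
    rw [PNat.mul_coe, Nat.cast_mul, Complex.natCast_mul_natCast_cpow]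

theorem norm_natCast_cpow_neg {n : ℕ} (hn : 0 < n) (s : ℂ) :
    ‖(n : ℂ) ^ (-s)‖ = (n : ℝ) ^ (-s.re) := by
  rw [Complex.norm_natCast_cpow_of_pos hn, Complex.neg_re]

theorem tsum_pnatCpow {s : ℂ} (hs : 1 < s.re) :
    (Summable fun n => ‖pnatCpow s n‖) ∧ ∑' n, pnatCpow s n = riemannZeta s := by
  have h0 : s ≠ 0 := by rintro rfl; simp at hs; linarith
  constructor
  · have h := (Real.summable_nat_rpow (p := -s.re)).2 (by linarith)
    refine (h.comp_injective PNat.coe_injective).congr fun n => ?_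
    exact (norm_natCast_cpow_neg n.pos s).symm
  · rw [zeta_eq_tsum_one_div_nat_cpow hs]
    have : ∀ n ∉ Set.range ((↑) : ℕ+ → ℕ), (1 / (n : ℂ) ^ s) = 0 := by
      intro n hn
      have : n = 0 := by
        by_contra h
        exact hn ⟨⟨n, Nat.pos_of_ne_zero h⟩, rfl⟩
      simp [this, Complex.zero_cpow h0]
    rw [← PNat.coe_injective.tsum_eq (f := fun n : ℕ => 1 / (n : ℂ) ^ s)
      (Function.support_subset_iff'.2 this)]
    refine tsum_congr fun n => ?_
    change (n : ℂ) ^ (-s) = _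
    rw [Complex.cpow_neg, one_div]

/-- The Dirichlet series of the increments is the product of `ζ` and a sum over prime powers. -/
theorem dirichletSeries_eq (hfin : ∀ n : ℕ, {p | (f p : ℕ) ≤ n}.Finite) {s : ℂ} (hs : 1 < s.re)
    (hsum : Summable fun b : PrimesOutside S × ℕ => ‖(Real.log (primeNorm b.1.1) : ℂ) *
      (((f b.1 : ℕ) * primeNorm b.1.1 ^ b.2 : ℕ) : ℂ) ^ (-s)‖) :
    LSeriesSummable (coeff f) s ∧ dirichletSeries f s =
      (∑' b : PrimesOutside S × ℕ, (Real.log (primeNorm b.1.1) : ℂ) *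
        (((f b.1 : ℕ) * primeNorm b.1.1 ^ b.2 : ℕ) : ℂ) ^ (-s)) * riemannZeta s := by
  obtain ⟨hχ, hζ⟩ := tsum_pnatCpow hs
  let d : PrimesOutside S × ℕ → ℕ+ := fun b =>
    ⟨(f b.1 : ℕ) * primeNorm b.1.1 ^ b.2, one_le_mul_primeNorm_pow f b.1 b.2⟩
  obtain ⟨h1, h2⟩ := hasSum_divisor_weights (pnatCpow s) d
    (fun b => (Real.log (primeNorm b.1.1) : ℂ)) hχ hsum (fun n => (increment f n : ℂ)) (by
      intro n
      have := (hasSum_increment f hfin n.ne_zero).mapL Complex.ofRealCLM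
      refine (funext fun b => ?_ : (fun b : PrimesOutside S × ℕ => _) = _) ▸ this
      rw [PNat.dvd_iff, Complex.ofRealCLM_apply, apply_ite Complex.ofReal, Complex.ofReal_zero]
      simp only [d, PNat.mk_coe]
      congr)
  have hoff : ∀ n ∉ Set.range ((↑) : ℕ+ → ℕ), LSeries.term (coeff f) s n = 0 := by
    intro n hn
    have : n = 0 := by
      by_contra h
      exact hn ⟨⟨n, Nat.pos_of_ne_zero h⟩, rfl⟩
    simp [this]
  have hterm : ∀ n : ℕ+, LSeries.term (coeff f) s n = (increment f n : ℂ) * pnatCpow s n := by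
    intro n
    rw [LSeries.term_of_ne_zero n.ne_zero, coeff, div_eq_mul_inv, ← Complex.cpow_neg]
    rfl
  have h3 : HasSum (LSeries.term (coeff f) s ∘ ((↑) : ℕ+ → ℕ)) _ :=
    (funext hterm : (LSeries.term (coeff f) s ∘ ((↑) : ℕ+ → ℕ)) = _) ▸ h2
  have h4 := (PNat.coe_injective.hasSum_iff hoff).1 h3
  refine ⟨h4.summable, ?_⟩
  rw [← hζ]
  exact h4.tsum_eq

theorem im_dirichletSeries (t : ℝ) : (dirichletSeries f t).im = 0 := by
  have : dirichletSeries f t =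
      ((∑' n, if n = 0 then 0 else increment f n / (n : ℝ) ^ t : ℝ) : ℂ) := by
    rw [dirichletSeries, LSeries, Complex.ofReal_tsum]
    refine tsum_congr fun n => ?_
    rcases eq_or_ne n 0 with rfl | hn
    · simp
    · rw [LSeries.term_of_ne_zero hn, if_neg hn, coeff]
      push_cast
      rw [Complex.ofReal_cpow (Nat.cast_nonneg n)]
      simp
  rw [this, Complex.ofReal_im]

end LegendreFactorial

end

/-! ### Analytic series and the halving identity for lattice sums -/

noncomputable section

namespace LegendreFactorial

/-- Each of the finitely many exceptional terms is bounded by compactness of the closed ball. So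
estimates are needed only for lattice points, or primes, of large norm. -/
theorem exists_summable_bound {α : Type*} {g : α → ℂ → ℂ} {r : ℝ} {a : ℂ}
    (hg : ∀ i, ContinuousOn (g i) (Metric.closedBall a r)) {u : α → ℝ} (hu : Summable u)
    (hle : ∀ᶠ i in cofinite, ∀ s ∈ Metric.ball a r, ‖g i s‖ ≤ u i) :
    ∃ u' : α → ℝ, Summable u' ∧ ∀ i, ∀ s ∈ Metric.ball a r, ‖g i s‖ ≤ u' i := by
  classical
  have hB : ∀ i, ∃ B, ∀ s ∈ Metric.closedBall a r, ‖g i s‖ ≤ B := fun i =>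
    (isCompact_closedBall a r).exists_bound_of_continuousOn (hg i)
  choose B hB using hB
  refine ⟨fun i => if ∀ s ∈ Metric.ball a r, ‖g i s‖ ≤ u i then u i else B i, ?_, ?_⟩
  · refine (summable_congr_cofinite ?_).2 hu
    filter_upwards [hle] with i hi
    rw [if_pos hi]
  · intro i s hs
    dsimp only
    split_ifs with h
    · exact h s hs
    · exact hB i s (Metric.ball_subset_closedBall hs)

theorem differentiableOn_tsum_of_eventually_norm_le {α : Type*} {g : α → ℂ → ℂ} {r : ℝ} {a : ℂ}
    (hg : ∀ i, DifferentiableOn ℂ (g i) (Metric.closedBall a r)) {u : α → ℝ} (hu : Summable u)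
    (hle : ∀ᶠ i in cofinite, ∀ s ∈ Metric.ball a r, ‖g i s‖ ≤ u i) :
    DifferentiableOn ℂ (fun s => ∑' i, g i s) (Metric.ball a r) := by
  obtain ⟨u', hu', hle'⟩ := exists_summable_bound (fun i => (hg i).continuousOn) hu hle
  exact Complex.differentiableOn_tsum_of_summable_norm hu'
    (fun i => (hg i).mono Metric.ball_subset_closedBall) Metric.isOpen_ball hle'

/-- Euclidean division by `2` in a lattice with a chosen basis. -/
def latticeDivTwo {ι L : Type*} [Fintype ι] [AddCommGroup L] (b : Module.Basis ι ℤ L) :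
    L × (ι → Fin 2) ≃ L :=
  (((b.equivFun.toEquiv.trans (Equiv.piCongrRight fun _ => Int.divModEquiv 2)).trans
    (Equiv.arrowProdEquivProdArrow ι (fun _ => ℤ) (fun _ => Fin 2))).trans
    (Equiv.prodCongr b.equivFun.toEquiv.symm (Equiv.refl _))).symm

theorem latticeDivTwo_apply {ι L : Type*} [Fintype ι] [AddCommGroup L] (b : Module.Basis ι ℤ L)
    (x : L) (ε : ι → Fin 2) :
    latticeDivTwo b (x, ε) = (2 : ℤ) • x + b.equivFun.symm (fun i => ((ε i : ℕ) : ℤ)) := by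
  change b.equivFun.symm (fun i => b.equivFun x i * (2 : ℕ) + ((ε i : ℕ) : ℤ)) = _
  rw [LinearEquiv.symm_apply_eq, map_add, map_smul, LinearEquiv.apply_symm_apply]
  ext i
  simp only [Pi.add_apply, Pi.smul_apply, smul_eq_mul]
  push_cast
  ring

/-- If the functions `Φ · s` are homogeneous and vary slowly, then their sum over a lattice
continues analytically after multiplication by `2 ^ (d s) - 2 ^ d`. -/
theorem exists_differentiableOn_lattice_sum {ι E : Type*} [Fintype ι] [AddCommGroup E] [Module ℝ E]
    {L : Submodule ℤ E} (b : Module.Basis ι ℤ L) (Φ : E → ℂ → ℂ) {r : ℝ}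
    (hdiff : ∀ x, Differentiable ℂ (Φ x))
    (hhom : ∀ x s, Φ ((1 / 2 : ℝ) • x) s = (2 : ℂ) ^ (Fintype.card ι * s) * Φ x s)
    (hpert : ∀ β : E, ∃ u : L → ℝ, Summable u ∧
      ∀ᶠ x : L in cofinite, ∀ s ∈ Metric.ball (1 : ℂ) r, ‖Φ (x + β) s - Φ x s‖ ≤ u x)
    (hsum : ∀ s : ℂ, 1 < s.re → Summable fun x : L => Φ x s) :
    ∃ H : ℂ → ℂ, DifferentiableOn ℂ H (Metric.ball 1 r) ∧ ∀ s ∈ Metric.ball (1 : ℂ) r, 1 < s.re →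
      ((2 : ℂ) ^ (Fintype.card ι * s) - 2 ^ Fintype.card ι) * ∑' x : L, Φ x s = H s := by
  classical
  -- Halves of the coset representatives `e_ε` of `2L` in `L`: writing `y = 2x + e_ε` turns `y/2`
  -- into `x + β ε`. There are `2 ^ card ι` of them, which accounts for the constant subtracted on
  -- the left.
  let β : (ι → Fin 2) → E := fun ε =>
    (1 / 2 : ℝ) • ((b.equivFun.symm (fun i => ((ε i : ℕ) : ℤ)) : L) : E)
  refine ⟨fun s => ∑ ε, ∑' x : L, (Φ (x + β ε) s - Φ x s), ?_, ?_⟩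
  · refine DifferentiableOn.fun_sum fun ε _ => ?_
    obtain ⟨u, hu, hle⟩ := hpert (β ε)
    exact differentiableOn_tsum_of_eventually_norm_le
      (fun x => ((hdiff _).sub (hdiff _)).differentiableOn) hu hle
  · intro s _ hs
    have h1 : HasSum (fun x : L => Φ ((1 / 2 : ℝ) • (x : E)) s)
        ((2 : ℂ) ^ (Fintype.card ι * s) * ∑' x : L, Φ x s) := by
      simp_rw [hhom]
      exact (hsum s hs).hasSum.mul_left _
    have h2 : HasSum (fun p : L × (ι → Fin 2) => Φ (p.1 + β p.2) s)
        ((2 : ℂ) ^ (Fintype.card ι * s) * ∑' x : L, Φ x s) := by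
      rw [← (latticeDivTwo b).hasSum_iff] at h1
      refine (funext fun p => ?_ : (fun p : L × (ι → Fin 2) => _) = _) ▸ h1
      obtain ⟨x, ε⟩ := p
      simp only [Function.comp_apply, latticeDivTwo_apply]
      congr 1
      simp only [Submodule.coe_add, Submodule.coe_smul, smul_add, β]
      congr 1
      rw [← Int.cast_smul_eq_zsmul ℝ, smul_smul]
      norm_num
    have h3 : HasSum (fun p : (ι → Fin 2) × L => Φ (p.2 + β p.1) s)
        ((2 : ℂ) ^ (Fintype.card ι * s) * ∑' x : L, Φ x s) := by
      rw [← (Equiv.prodComm _ _).hasSum_iff] at h2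
      exact h2
    have h4 : ∀ ε, Summable fun x : L => Φ (x + β ε) s := fun ε =>
      h3.summable.prod_factor ε
    have h5 := (h3.prod_fiberwise fun ε => (h4 ε).hasSum).unique (hasSum_fintype _)
    rw [sub_mul, h5]
    have h6 : ∀ ε, ∑' x : L, (Φ (x + β ε) s - Φ x s) =
        ∑' x : L, Φ (x + β ε) s - ∑' x : L, Φ x s := fun ε => (h4 ε).tsum_sub (hsum s hs)
    simp_rw [h6]
    rw [Finset.sum_sub_distrib]
    simp

end LegendreFactorial

end

/-! ### Tent functions and the weight on the mixed space -/

noncomputable section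

namespace LegendreFactorial

open NumberField.InfinitePlace NumberField.mixedEmbedding NumberField.Units
  NumberField.Units.dirichletUnitTheorem Module
open scoped Classical

/-- The tent function. -/
def tent (t : ℝ) : ℝ := max 0 (1 - |t|)

theorem tent_nonneg (t : ℝ) : 0 ≤ tent t := le_max_left _ _

theorem tent_le_one (t : ℝ) : tent t ≤ 1 :=
  max_le zero_le_one (by linarith [abs_nonneg t])

theorem abs_lt_one_of_tent_ne_zero {t : ℝ} (h : tent t ≠ 0) : |t| < 1 := by
  by_contra h1
  exact h (max_eq_left (by linarith))

theorem abs_tent_sub_tent_le (a b : ℝ) : |tent a - tent b| ≤ |a - b| := by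
  have h := abs_max_sub_max_le_abs (1 - |a|) (1 - |b|) 0
  rw [max_comm, max_comm _ (0 : ℝ)] at h
  refine h.trans ?_ |>.trans (abs_abs_sub_abs_le b a) |>.trans (abs_sub_comm _ _).le
  refine le_of_eq ?_
  congr 1
  ring

/-- The factors lie in `[0, 1]` and the tent is 1-Lipschitz, so exchanging the factors one at a time
costs at most `|a i - b i|` each. -/
theorem abs_prod_tent_sub_prod_tent_le {ι : Type*} (t : Finset ι) (a b : ι → ℝ) :
    |∏ i ∈ t, tent (a i) - ∏ i ∈ t, tent (b i)| ≤ ∑ i ∈ t, |a i - b i| := by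
  classical
  induction t using Finset.induction_on with
  | empty => simp
  | insert i t hi ih =>
    rw [Finset.prod_insert hi, Finset.prod_insert hi, Finset.sum_insert hi]
    have h1 : |tent (a i)| ≤ 1 := by rw [abs_of_nonneg (tent_nonneg _)]; exact tent_le_one _
    have h2 : |∏ i ∈ t, tent (b i)| ≤ 1 := by
      rw [abs_of_nonneg (Finset.prod_nonneg fun _ _ => tent_nonneg _)]
      exact Finset.prod_le_one (fun _ _ => tent_nonneg _) fun _ _ => tent_le_one _
    calc |tent (a i) * ∏ i ∈ t, tent (a i) - tent (b i) * ∏ i ∈ t, tent (b i)|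
        = |(tent (a i) - tent (b i)) * ∏ i ∈ t, tent (b i) +
            tent (a i) * (∏ i ∈ t, tent (a i) - ∏ i ∈ t, tent (b i))| := by congr 1; ring
      _ ≤ |tent (a i) - tent (b i)| * |∏ i ∈ t, tent (b i)| +
            |tent (a i)| * |∏ i ∈ t, tent (a i) - ∏ i ∈ t, tent (b i)| := by
          rw [← abs_mul, ← abs_mul]; exact abs_add_le _ _
      _ ≤ |a i - b i| * 1 + 1 * ∑ i ∈ t, |a i - b i| := by
          exact add_le_add
            (mul_le_mul (abs_tent_sub_tent_le _ _) h2 (abs_nonneg _) (abs_nonneg _))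
            (mul_le_mul h1 ih (abs_nonneg _) zero_le_one)
      _ = _ := by ring

/-- With `u` the fractional part of `t`, the two translates of `t` are `u` and `u - 1`, where the
tent takes the values `1 - u` and `u`. -/
theorem sum_tent_floor (t : ℝ) :
    ∑ n ∈ ({-⌊t⌋, -⌊t⌋ - 1} : Finset ℤ), tent (t + n) = 1 := by
  rw [Finset.sum_pair (by omega)]
  have h0 := Int.floor_le t
  have h1 := Int.lt_floor_add_one t
  push_cast
  rw [tent, tent, abs_of_nonneg (by linarith), abs_of_nonpos (by linarith),
    max_eq_right (by linarith), max_eq_right (by linarith)]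
  ring

theorem tent_add_int_eq_zero {t : ℝ} {n : ℤ} (hn : n ∉ ({-⌊t⌋, -⌊t⌋ - 1} : Finset ℤ)) :
    tent (t + n) = 0 := by
  by_contra h
  have h2 := abs_lt.1 (abs_lt_one_of_tent_ne_zero h)
  have h0 := Int.floor_le t
  have h1 := Int.lt_floor_add_one t
  simp only [Finset.mem_insert, Finset.mem_singleton, not_or] at hn
  have e1 : -⌊t⌋ - 2 < n := by
    have : ((-⌊t⌋ - 2 : ℤ) : ℝ) < n := by push_cast; linarith [h2.1]
    exact_mod_cast this
  have e2 : n < -⌊t⌋ + 1 := by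
    have : (n : ℝ) < ((-⌊t⌋ + 1 : ℤ) : ℝ) := by push_cast; linarith [h2.2]
    exact_mod_cast this
  omega

/-- The integer translates of a product of tent functions form a partition of unity. -/
theorem hasSum_prod_tent {ι : Type*} [Fintype ι] (t : ι → ℝ) :
    HasSum (fun n : ι → ℤ => ∏ i, tent (t i + n i)) 1 := by
  classical
  have h : ∑ n ∈ Fintype.piFinset (fun i => ({-⌊t i⌋, -⌊t i⌋ - 1} : Finset ℤ)),
      ∏ i, tent (t i + n i) = 1 := by
    rw [← Finset.prod_univ_sum (fun i => ({-⌊t i⌋, -⌊t i⌋ - 1} : Finset ℤ))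
      (fun i n => tent (t i + n))]
    exact Finset.prod_eq_one fun i _ => sum_tent_floor (t i)
  rw [← h]
  refine hasSum_sum_of_ne_finset_zero fun n hn => ?_
  rw [Fintype.mem_piFinset, not_forall] at hn
  obtain ⟨i, hi⟩ := hn
  exact Finset.prod_eq_zero (Finset.mem_univ i) (tent_add_int_eq_zero hi)

theorem abs_log_le_two_mul {z τ : ℝ} (hτ : τ ≤ 1 / 2) (hz : |z - 1| ≤ τ) :
    |Real.log z| ≤ 2 * τ := by
  obtain ⟨h1, h2⟩ := abs_le.1 hz
  have hz0 : 0 < z := by linarith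
  rw [abs_le]
  constructor
  · have := Real.one_sub_inv_le_log_of_pos hz0
    refine le_trans ?_ this
    have h3 : z⁻¹ ≤ 1 + 2 * τ := by
      rw [inv_le_iff_one_le_mul₀ hz0]
      nlinarith
    linarith
  · have := Real.log_le_sub_one_of_pos hz0
    linarith

variable (K : Type*) [Field K] [NumberField K]

/-- The real basis of the logarithmic space given by a system of fundamental units. -/
def unitBasis : Basis (Fin (rank K)) ℝ (logSpace K) :=
  (basisUnitLattice K).ofZLatticeBasis ℝ (unitLattice K)

variable {K}

/-- A degree zero homogeneous weight whose translates by the units form a partition of unity up to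
torsion. -/
def coneWeight (x : mixedSpace K) : ℝ :=
  if mixedEmbedding.norm x = 0 then 0 else ∏ i, tent ((unitBasis K).equivFun (logMap x) i)

theorem coneWeight_nonneg (x : mixedSpace K) : 0 ≤ coneWeight x := by
  rw [coneWeight]
  split_ifs
  exacts [le_rfl, Finset.prod_nonneg fun _ _ => tent_nonneg _]

theorem coneWeight_le_one (x : mixedSpace K) : coneWeight x ≤ 1 := by
  rw [coneWeight]
  split_ifs
  exacts [zero_le_one, Finset.prod_le_one (fun _ _ => tent_nonneg _) fun _ _ => tent_le_one _]

theorem norm_ne_zero_of_coneWeight_ne_zero {x : mixedSpace K} (hx : coneWeight x ≠ 0) :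
    mixedEmbedding.norm x ≠ 0 := by
  intro h
  exact hx (if_pos h)

theorem coneWeight_smul (x : mixedSpace K) {c : ℝ} (hc : c ≠ 0) :
    coneWeight (c • x) = coneWeight x := by
  have h : mixedEmbedding.norm (c • x) = 0 ↔ mixedEmbedding.norm x = 0 := by
    rw [mixedEmbedding.norm_smul, mul_eq_zero, or_iff_right]
    exact pow_ne_zero _ (abs_ne_zero.2 hc)
  rw [coneWeight, coneWeight]
  by_cases hx : mixedEmbedding.norm x = 0
  · rw [if_pos hx, if_pos (h.2 hx)]
  · rw [if_neg hx, if_neg (h.not.2 hx), logMap_real_smul hx hc]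

theorem log_norm_eq_sum {x : mixedSpace K} (hx : mixedEmbedding.norm x ≠ 0) :
    Real.log (mixedEmbedding.norm x) = ∑ v : InfinitePlace K, mult v * Real.log (normAtPlace v x) := by
  rw [mixedEmbedding.norm_apply, Real.log_prod]
  · simp_rw [Real.log_pow]
  · exact fun v _ => pow_ne_zero _ (mixedEmbedding.norm_ne_zero_iff.1 hx v)

/-- On the support of the weight all archimedean absolute values are comparable. -/
theorem exists_forall_normAtPlace_ge (K : Type*) [Field K] [NumberField K] :
    ∃ ε : ℝ, 0 < ε ∧ ε ≤ 1 ∧ ∀ x : mixedSpace K, coneWeight x ≠ 0 →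
      ∀ v, ε * ‖x‖ ≤ normAtPlace v x := by
  obtain ⟨M, hM0, hM⟩ := (unitBasis K).equivFunL.symm.toContinuousLinearMap.bound
  -- On the support the coordinates in the unit basis are at most 1, so `logMap x` is bounded by
  -- `M`. Every `log |x|_v` is then within `Λ` of the mean `log N(x) / d`, and any two differ by at
  -- most `2Λ`.
  set Λ : ℝ := (Fintype.card (InfinitePlace K) : ℝ) * M with hΛ
  have hcard : (1 : ℝ) ≤ Fintype.card (InfinitePlace K) := by
    exact_mod_cast Fintype.card_pos
  have hΛ0 : 0 ≤ Λ := by positivity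
  refine ⟨Real.exp (-(2 * Λ)), Real.exp_pos _, Real.exp_le_one_iff.2 (by linarith), ?_⟩
  intro x hx v
  have hN := norm_ne_zero_of_coneWeight_ne_zero hx
  have hpos : ∀ v, 0 < normAtPlace v x := fun v =>
    (normAtPlace_nonneg v x).lt_of_ne' (mixedEmbedding.norm_ne_zero_iff.1 hN v)
  have hlogMap : ‖logMap x‖ ≤ M := by
    rw [coneWeight, if_neg hN, Finset.prod_ne_zero_iff] at hx
    have h1 : ‖(unitBasis K).equivFunL (logMap x)‖ ≤ 1 := by
      refine (pi_norm_le_iff_of_nonneg zero_le_one).2 fun i => ?_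
      exact (abs_lt_one_of_tent_ne_zero (hx i (Finset.mem_univ i))).le
    have h2 := hM ((unitBasis K).equivFunL (logMap x))
    simp only [ContinuousLinearEquiv.coe_coe, ContinuousLinearEquiv.symm_apply_apply] at h2
    nlinarith
  set lam : ℝ := Real.log (mixedEmbedding.norm x) * (finrank ℚ K : ℝ)⁻¹ with hlam
  have hcoord : ∀ w : {w : InfinitePlace K // w ≠ w₀},
      |(mult w.1 : ℝ) * (Real.log (normAtPlace w.1 x) - lam)| ≤ M := fun w =>
    (norm_le_pi_norm (logMap x) w).trans hlogMap
  -- `logMap` omits the place `w₀`; this relation bounds its coordinate by the others.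
  have hsum : ∑ v : InfinitePlace K, (mult v : ℝ) * (Real.log (normAtPlace v x) - lam) = 0 := by
    simp_rw [mul_sub, Finset.sum_sub_distrib, ← Finset.sum_mul]
    rw [← log_norm_eq_sum hN, ← Nat.cast_sum, sum_mult_eq, hlam]
    have : (finrank ℚ K : ℝ) ≠ 0 := by exact_mod_cast finrank_pos.ne'
    field_simp
    ring
  have hall : ∀ v, |Real.log (normAtPlace v x) - lam| ≤ Λ := by
    intro v
    have h1 : |Real.log (normAtPlace v x) - lam| ≤
        |(mult v : ℝ) * (Real.log (normAtPlace v x) - lam)| := by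
      rw [abs_mul, Nat.abs_cast]
      exact le_mul_of_one_le_left (abs_nonneg _) one_le_mult
    refine h1.trans ?_
    by_cases hv : v = w₀
    · rw [← Finset.add_sum_erase _ _ (Finset.mem_univ v)] at hsum
      rw [eq_neg_of_add_eq_zero_left hsum, abs_neg]
      refine (Finset.abs_sum_le_sum_abs _ _).trans ?_
      refine (Finset.sum_le_card_nsmul _ _ M fun w hw => ?_).trans ?_
      · exact hcoord ⟨w, fun h => (Finset.ne_of_mem_erase hw) (h.trans hv.symm)⟩
      · rw [nsmul_eq_mul]
        exact mul_le_mul_of_nonneg_right (by exact_mod_cast Finset.card_le_univ _) hM0.le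
    · exact (hcoord ⟨v, hv⟩).trans (le_mul_of_one_le_left hM0.le hcard)
  obtain ⟨v', -, hv'⟩ := Finset.exists_mem_eq_sup' Finset.univ_nonempty
    (fun w : InfinitePlace K => normAtPlace w x)
  rw [norm_eq_sup'_normAtPlace, hv', ← Real.exp_log (hpos v'), ← Real.exp_add,
    ← Real.le_log_iff_exp_le (hpos v)]
  have h1 := abs_le.1 (hall v)
  have h2 := abs_le.1 (hall v')
  linarith [h1.1, h2.2]

theorem normAtPlace_le_norm (v : InfinitePlace K) (x : mixedSpace K) : normAtPlace v x ≤ ‖x‖ := by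
  rw [norm_eq_sup'_normAtPlace]
  exact Finset.le_sup' (fun w => normAtPlace w x) (Finset.mem_univ v)

theorem abs_normAtPlace_sub_le (v : InfinitePlace K) (x y : mixedSpace K) :
    |normAtPlace v y - normAtPlace v x| ≤ ‖y - x‖ := by
  have h1 := normAtPlace_add_le v (y - x) x
  have h2 := normAtPlace_add_le v (-(y - x)) y
  have h3 := normAtPlace_le_norm v (y - x)
  rw [normAtPlace_neg] at h2
  rw [sub_add_cancel] at h1
  rw [neg_sub, sub_add_cancel] at h2
  rw [abs_le]
  constructor <;> linarith

theorem pow_le_mixedEmbedding_norm {x : mixedSpace K} {t : ℝ} (ht : 0 ≤ t)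
    (h : ∀ v, t ≤ normAtPlace v x) : t ^ finrank ℚ K ≤ mixedEmbedding.norm x := by
  rw [mixedEmbedding.norm_apply, ← sum_mult_eq, ← Finset.prod_pow_eq_pow_sum]
  exact Finset.prod_le_prod (fun _ _ => pow_nonneg ht _) fun v _ => pow_le_pow_left₀ ht (h v) _

/-- `log N` and the coordinates of `logMap` are linear in the numbers `log |x|_v`, and a product of
tents is Lipschitz in those coordinates. -/
theorem exists_abs_coneWeight_sub_le (K : Type*) [Field K] [NumberField K] :
    ∃ C : ℝ, 0 ≤ C ∧ ∀ x y : mixedSpace K, mixedEmbedding.norm x ≠ 0 → mixedEmbedding.norm y ≠ 0 →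
      ∀ η : ℝ, (∀ v, |Real.log (normAtPlace v y) - Real.log (normAtPlace v x)| ≤ η) →
        |coneWeight y - coneWeight x| ≤ C * η ∧
        |Real.log (mixedEmbedding.norm y) - Real.log (mixedEmbedding.norm x)| ≤
          finrank ℚ K * η := by
  obtain ⟨M, hM0, hM⟩ := (unitBasis K).equivFunL.toContinuousLinearMap.bound
  -- The 4 is a multiplicity of at most 2 times `2η`: one `η` from the place itself, one from the
  -- mean `log N / d`.
  refine ⟨rank K * (M * 4), by positivity, fun x y hx hy η h => ?_⟩
  have hη : 0 ≤ η := (abs_nonneg _).trans (h w₀)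
  have hd : (0 : ℝ) < finrank ℚ K := by exact_mod_cast finrank_pos
  have hlogN : |Real.log (mixedEmbedding.norm y) - Real.log (mixedEmbedding.norm x)| ≤
      finrank ℚ K * η := by
    rw [log_norm_eq_sum hx, log_norm_eq_sum hy, ← Finset.sum_sub_distrib, ← sum_mult_eq,
      Nat.cast_sum, Finset.sum_mul]
    refine (Finset.abs_sum_le_sum_abs _ _).trans (Finset.sum_le_sum fun v _ => ?_)
    rw [← mul_sub, abs_mul, abs_of_nonneg (Nat.cast_nonneg _)]
    exact mul_le_mul_of_nonneg_left (h v) (Nat.cast_nonneg _)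
  refine ⟨?_, hlogN⟩
  have hlogMap : ‖logMap y - logMap x‖ ≤ 4 * η := by
    refine (pi_norm_le_iff_of_nonneg (by positivity)).2 fun w => ?_
    rw [Pi.sub_apply, logMap_apply, logMap_apply, ← mul_sub, norm_mul]
    have h1 : ‖(mult w.1 : ℝ)‖ ≤ 2 := by
      rw [Real.norm_natCast, InfinitePlace.mult]
      split_ifs <;> norm_num
    have h2 : |(Real.log (mixedEmbedding.norm y) - Real.log (mixedEmbedding.norm x)) *
        (finrank ℚ K : ℝ)⁻¹| ≤ η := by
      rw [abs_mul, abs_of_pos (inv_pos.2 hd), ← div_eq_mul_inv, div_le_iff₀ hd]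
      linarith
    have h3 : ‖Real.log (normAtPlace w.1 y) - Real.log (mixedEmbedding.norm y) *
        (finrank ℚ K : ℝ)⁻¹ - (Real.log (normAtPlace w.1 x) - Real.log (mixedEmbedding.norm x) *
        (finrank ℚ K : ℝ)⁻¹)‖ ≤ 2 * η := by
      rw [Real.norm_eq_abs, abs_le]
      rw [sub_mul] at h2
      have h4 := abs_le.1 h2
      have h5 := abs_le.1 (h w.1)
      constructor <;> linarith [h4.1, h4.2, h5.1, h5.2]
    calc _ ≤ 2 * (2 * η) := mul_le_mul h1 h3 (norm_nonneg _) (by norm_num)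
      _ = 4 * η := by ring
  rw [coneWeight, coneWeight, if_neg hx, if_neg hy]
  refine (abs_prod_tent_sub_prod_tent_le _ _ _).trans ?_
  refine (Finset.sum_le_card_nsmul _ _ (M * (4 * η)) fun i _ => ?_).trans ?_
  · have h1 := norm_le_pi_norm ((unitBasis K).equivFunL (logMap y - logMap x)) i
    rw [map_sub] at h1
    have h2 := hM (logMap y - logMap x)
    rw [ContinuousLinearEquiv.coe_coe, map_sub] at h2
    exact h1.trans (h2.trans (mul_le_mul_of_nonneg_left hlogMap hM0.le))
  · simp only [Finset.card_univ, Fintype.card_fin, nsmul_eq_mul]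
    exact le_of_eq (by ring)

end LegendreFactorial

end

/-! ### The weighted lattice sum -/

noncomputable section

namespace LegendreFactorial

open NumberField.InfinitePlace NumberField.mixedEmbedding NumberField.Units
  NumberField.Units.dirichletUnitTheorem Module
open scoped Classical

variable {K : Type*} [Field K] [NumberField K]

/-- The weighted norm power `w(x) N(x) ^ (-s)`. -/
def coneTerm (x : mixedSpace K) (s : ℂ) : ℂ :=
  (coneWeight x : ℂ) * ((mixedEmbedding.norm x : ℝ) : ℂ) ^ (-s)

theorem coneTerm_eq_zero {x : mixedSpace K} (hx : coneWeight x = 0) (s : ℂ) : coneTerm x s = 0 := by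
  rw [coneTerm, hx, Complex.ofReal_zero, zero_mul]

theorem differentiable_coneTerm (x : mixedSpace K) : Differentiable ℂ (coneTerm x) := by
  by_cases hx : coneWeight x = 0
  · rw [show coneTerm x = fun _ => 0 from funext (coneTerm_eq_zero hx)]
    exact differentiable_const _
  · have : ((mixedEmbedding.norm x : ℝ) : ℂ) ≠ 0 := by
      exact_mod_cast norm_ne_zero_of_coneWeight_ne_zero hx
    exact fun s => ((differentiableAt_id.neg).const_cpow (Or.inl this)).const_mul _

theorem coneTerm_half_smul (x : mixedSpace K) (s : ℂ) :
    coneTerm ((1 / 2 : ℝ) • x) s = (2 : ℂ) ^ (finrank ℚ K * s) * coneTerm x s := by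
  rw [coneTerm, coneTerm, coneWeight_smul x (by norm_num), mixedEmbedding.norm_smul,
    Complex.ofReal_mul, Complex.mul_cpow_ofReal_nonneg (by positivity)
      (mixedEmbedding.norm_nonneg x)]
  have : (((|1 / 2| : ℝ) ^ finrank ℚ K : ℝ) : ℂ) ^ (-s) = (2 : ℂ) ^ (finrank ℚ K * s) := by
    have h0 : (0 : ℝ) < |1 / 2| ^ finrank ℚ K := by positivity
    have h1 : Real.log (|1 / 2| ^ finrank ℚ K) = -(finrank ℚ K * Real.log 2) := by
      rw [Real.log_pow, abs_of_pos (by norm_num : (0 : ℝ) < 1 / 2), one_div, Real.log_inv]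
      ring
    have h2 : Complex.log 2 = (Real.log 2 : ℂ) := by
      rw [Complex.ofReal_log (by norm_num), Complex.ofReal_ofNat]
    rw [Complex.cpow_def_of_ne_zero (by exact_mod_cast h0.ne'),
      Complex.cpow_def_of_ne_zero two_ne_zero, ← Complex.ofReal_log h0.le, h1, h2]
    congr 1
    push_cast
    ring
  rw [this]
  ring

theorem norm_coneTerm_le {x : mixedSpace K} (s : ℂ) :
    ‖coneTerm x s‖ ≤ coneWeight x * mixedEmbedding.norm x ^ (-s.re) := by
  by_cases hx : coneWeight x = 0
  · rw [coneTerm_eq_zero hx, hx]; simp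
  have hN : 0 < mixedEmbedding.norm x :=
    (mixedEmbedding.norm_nonneg x).lt_of_ne' (norm_ne_zero_of_coneWeight_ne_zero hx)
  rw [coneTerm, norm_mul, Complex.norm_real, Real.norm_of_nonneg (coneWeight_nonneg x),
    Complex.norm_cpow_eq_rpow_re_of_pos hN, Complex.neg_re]

theorem norm_rpow_le_of_forall_le {x : mixedSpace K} {ε σ : ℝ} (hε : 0 < ε) (hx : x ≠ 0)
    (h : ∀ v, ε * ‖x‖ ≤ normAtPlace v x) (hσ : 0 ≤ σ) :
    mixedEmbedding.norm x ^ (-σ) ≤ ε ^ (-(finrank ℚ K * σ)) * ‖x‖ ^ (-(finrank ℚ K * σ)) := by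
  have hx' : 0 < ‖x‖ := norm_pos_iff.2 hx
  have h1 := pow_le_mixedEmbedding_norm (by positivity) h
  rw [← Real.mul_rpow hε.le hx'.le, ← mul_neg, Real.rpow_mul (by positivity), Real.rpow_natCast]
  exact Real.rpow_le_rpow_of_nonpos (by positivity) h1 (by linarith)

/-- On the support of the weight `N(x) ≥ (ε ‖x‖)^d`, so the series is dominated by `∑ ‖x‖^(-d σ)`,
with `d σ` larger than the rank `d`. -/
theorem summable_coneTerm (L : Submodule ℤ (mixedSpace K)) [DiscreteTopology L] [IsZLattice ℝ L]
    {s : ℂ} (hs : 1 < s.re) : Summable fun x : L => ‖coneTerm (x : mixedSpace K) s‖ := by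
  obtain ⟨ε, hε, -, h⟩ := exists_forall_normAtPlace_ge K
  have hd : (0 : ℝ) < finrank ℚ K := by exact_mod_cast finrank_pos
  have hr : -(finrank ℚ K * s.re) < -(finrank ℤ L : ℝ) := by
    rw [ZLattice.rank ℝ L, mixedEmbedding.finrank]
    nlinarith
  refine Summable.of_nonneg_of_le (fun _ => norm_nonneg _) (fun x => ?_)
    ((ZLattice.summable_norm_rpow L _ hr).mul_left (ε ^ (-(finrank ℚ K * s.re))))
  by_cases hx : coneWeight (x : mixedSpace K) = 0
  · rw [coneTerm_eq_zero hx, norm_zero]; positivity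
  have hx0 : (x : mixedSpace K) ≠ 0 := by
    intro h0
    exact norm_ne_zero_of_coneWeight_ne_zero hx (by rw [h0, map_zero])
  refine (norm_coneTerm_le s).trans ?_
  refine le_trans ?_ (norm_rpow_le_of_forall_le hε hx0 (h x hx) (by linarith))
  exact mul_le_of_le_one_left (Real.rpow_nonneg (mixedEmbedding.norm_nonneg _) _)
    (coneWeight_le_one _)

/-- Perturbing the argument of `coneTerm` by a bounded amount saves a power of `‖x‖`. -/
theorem exists_norm_coneTerm_sub_le (K : Type*) [Field K] [NumberField K] {T : ℝ} (hT : 0 ≤ T) :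
    ∃ R C : ℝ, 1 ≤ R ∧ 0 ≤ C ∧ ∀ x y : mixedSpace K, coneWeight x ≠ 0 → R ≤ ‖x‖ → ‖y - x‖ ≤ T →
      ∀ s ∈ Metric.ball (1 : ℂ) (1 / (2 * finrank ℚ K)),
        ‖coneTerm y s - coneTerm x s‖ ≤ C * ‖x‖ ^ (-(finrank ℚ K + 1 / 2) : ℝ) := by
  obtain ⟨ε, hε, hε1, h⟩ := exists_forall_normAtPlace_ge K
  obtain ⟨C₁, hC₁, hw⟩ := exists_abs_coneWeight_sub_le K
  set d : ℝ := (finrank ℚ K : ℝ) with hd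
  have hd1 : 1 ≤ d := by
    have : 0 < finrank ℚ K := finrank_pos
    rw [hd]; exact_mod_cast this
  -- The relative perturbation at each place is at most `τ = T / (ε ‖x‖)`, and `R` forces `4 d τ ≤
  -- 1`, as the exponential estimate requires. In `C`, `3 C₁` comes from the change of the weight
  -- and `4 d` from that of the norm power. On the disc `d · Re s > d - 1/2`; together with the
  -- factor `‖x‖⁻¹` in `τ` this gives the exponent `-(d + 1/2)`.
  refine ⟨4 * d * T / ε + 1, (3 * C₁ + 4 * d) * (2 * T / ε) * ε ^ (-(2 * d)), ?_, by positivity, ?_⟩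
  · have : 0 ≤ 4 * d * T / ε := by positivity
    linarith
  intro x y hx hR hyx s hs
  have hRT : 0 ≤ 4 * d * T / ε := by positivity
  have hx1 : 1 ≤ ‖x‖ := by linarith
  have hxpos : 0 < ‖x‖ := by linarith
  have hx0 : x ≠ 0 := norm_pos_iff.1 hxpos
  set τ : ℝ := T / (ε * ‖x‖) with hτ
  have hτ0 : 0 ≤ τ := by positivity
  have hτ1 : 4 * d * τ ≤ 1 := by
    rw [hτ, ← mul_div_assoc, div_le_one (by positivity)]
    have h1 : 4 * d * T / ε ≤ ‖x‖ := by linarith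
    rw [div_le_iff₀ hε] at h1
    linarith
  have hτ2 : τ ≤ 1 / 2 := by nlinarith
  have hxv : ∀ v, 0 < normAtPlace v x := fun v => lt_of_lt_of_le (by positivity) (h x hx v)
  have hratio : ∀ v, |normAtPlace v y / normAtPlace v x - 1| ≤ τ := by
    intro v
    rw [div_sub_one (hxv v).ne', abs_div, abs_of_pos (hxv v), div_le_iff₀ (hxv v)]
    refine (abs_normAtPlace_sub_le v x y).trans (hyx.trans ?_)
    have h1 : τ * (ε * ‖x‖) = T := by
      rw [hτ]; field_simp
    rw [← h1]
    exact mul_le_mul_of_nonneg_left (h x hx v) hτ0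
  have hyv : ∀ v, 0 < normAtPlace v y := by
    intro v
    have h1 := (abs_le.1 (hratio v)).1
    have h2 : 0 < normAtPlace v y / normAtPlace v x := by linarith
    exact (div_pos_iff_of_pos_right (hxv v)).1 h2
  have hNx : 0 < mixedEmbedding.norm x := (mixedEmbedding.norm_nonneg x).lt_of_ne'
    (mixedEmbedding.norm_ne_zero_iff.2 fun v => (hxv v).ne')
  have hNy : 0 < mixedEmbedding.norm y := (mixedEmbedding.norm_nonneg y).lt_of_ne'
    (mixedEmbedding.norm_ne_zero_iff.2 fun v => (hyv v).ne')
  have hlog : ∀ v, |Real.log (normAtPlace v y) - Real.log (normAtPlace v x)| ≤ 2 * τ := by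
    intro v
    rw [← Real.log_div (hyv v).ne' (hxv v).ne']
    exact abs_log_le_two_mul hτ2 (hratio v)
  obtain ⟨hw1, hN1⟩ := hw x y hNx.ne' hNy.ne' _ hlog
  rw [Metric.mem_ball, dist_eq_norm] at hs
  have hr : 1 / (2 * d) ≤ 1 / 2 := by
    rw [div_le_div_iff₀ (by positivity) (by norm_num)]; linarith
  have hs2 : ‖s‖ ≤ 2 := by
    calc ‖s‖ = ‖(s - 1) + 1‖ := by ring_nf
      _ ≤ ‖s - 1‖ + ‖(1 : ℂ)‖ := norm_add_le _ _
      _ ≤ 2 := by rw [norm_one]; linarith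
  have hre := abs_le.1 ((Complex.abs_re_le_norm (s - 1)).trans hs.le)
  simp only [Complex.sub_re, Complex.one_re] at hre
  set Δ : ℝ := Real.log (mixedEmbedding.norm y) - Real.log (mixedEmbedding.norm x) with hΔ
  have hcpow : ((mixedEmbedding.norm y : ℝ) : ℂ) ^ (-s) =
      ((mixedEmbedding.norm x : ℝ) : ℂ) ^ (-s) * Complex.exp (-s * Δ) := by
    rw [Complex.cpow_def_of_ne_zero (by exact_mod_cast hNy.ne'),
      Complex.cpow_def_of_ne_zero (by exact_mod_cast hNx.ne'), ← Complex.exp_add,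
      ← Complex.ofReal_log hNx.le, ← Complex.ofReal_log hNy.le, hΔ]
    congr 1
    push_cast
    ring
  set X : ℂ := ((mixedEmbedding.norm x : ℝ) : ℂ) ^ (-s) with hX
  have harg : ‖-s * (Δ : ℂ)‖ ≤ 4 * d * τ := by
    rw [norm_mul, norm_neg, Complex.norm_real]
    calc ‖s‖ * ‖Δ‖ ≤ 2 * (d * (2 * τ)) := mul_le_mul hs2 hN1 (norm_nonneg _) (by norm_num)
      _ = 4 * d * τ := by ring
  have hexp : ‖Complex.exp (-s * Δ) - 1‖ ≤ 2 * (4 * d * τ) :=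
    (Complex.norm_exp_sub_one_le (harg.trans hτ1)).trans (by linarith)
  have hexp3 : ‖Complex.exp (-s * Δ)‖ ≤ 3 := by
    calc ‖Complex.exp (-s * Δ)‖ = ‖(Complex.exp (-s * Δ) - 1) + 1‖ := by ring_nf
      _ ≤ ‖Complex.exp (-s * Δ) - 1‖ + ‖(1 : ℂ)‖ := norm_add_le _ _
      _ ≤ 3 := by rw [norm_one]; linarith
  have hXle : ‖X‖ ≤ ε ^ (-(2 * d)) * ‖x‖ ^ (-(d - 1 / 2)) := by
    rw [hX, Complex.norm_cpow_eq_rpow_re_of_pos hNx, Complex.neg_re]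
    refine (norm_rpow_le_of_forall_le hε hx0 (h x hx) (by linarith)).trans ?_
    refine mul_le_mul ?_ ?_ (by positivity) (by positivity)
    · refine Real.rpow_le_rpow_of_exponent_ge hε hε1 ?_
      have : d * s.re ≤ d * 2 := mul_le_mul_of_nonneg_left (by linarith) (by linarith)
      linarith
    · refine Real.rpow_le_rpow_of_exponent_le hx1 ?_
      have h1 : d * (1 - 1 / (2 * d)) ≤ d * s.re :=
        mul_le_mul_of_nonneg_left (by linarith) (by linarith)
      have h2 : d * (1 - 1 / (2 * d)) = d - 1 / 2 := by field_simp
      linarith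
  have hdecomp : coneTerm y s - coneTerm x s =
      ((coneWeight y - coneWeight x : ℝ) : ℂ) * (X * Complex.exp (-s * Δ)) +
        (coneWeight x : ℂ) * (X * (Complex.exp (-s * Δ) - 1)) := by
    rw [coneTerm, coneTerm, hcpow]
    push_cast
    ring
  have hwx : ‖(coneWeight x : ℂ)‖ ≤ 1 := by
    rw [Complex.norm_real, Real.norm_of_nonneg (coneWeight_nonneg x)]
    exact coneWeight_le_one x
  rw [hdecomp]
  calc _ ≤ ‖((coneWeight y - coneWeight x : ℝ) : ℂ)‖ * (‖X‖ * ‖Complex.exp (-s * Δ)‖) +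
        ‖(coneWeight x : ℂ)‖ * (‖X‖ * ‖Complex.exp (-s * Δ) - 1‖) := by
        refine (norm_add_le _ _).trans_eq ?_
        simp only [norm_mul]
    _ ≤ (C₁ * (2 * τ)) * (‖X‖ * 3) + 1 * (‖X‖ * (2 * (4 * d * τ))) := by
        rw [Complex.norm_real]
        exact add_le_add (mul_le_mul hw1 (mul_le_mul_of_nonneg_left hexp3 (norm_nonneg _))
          (by positivity) (by positivity))
          (mul_le_mul hwx (mul_le_mul_of_nonneg_left hexp (norm_nonneg _)) (by positivity)
            zero_le_one)
    _ = (3 * C₁ + 4 * d) * (2 * τ) * ‖X‖ := by ring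
    _ ≤ (3 * C₁ + 4 * d) * (2 * τ) * (ε ^ (-(2 * d)) * ‖x‖ ^ (-(d - 1 / 2))) := by gcongr
    _ = (3 * C₁ + 4 * d) * (2 * T / ε) * ε ^ (-(2 * d)) * (‖x‖⁻¹ * ‖x‖ ^ (-(d - 1 / 2))) := by
        rw [hτ]; field_simp
    _ = _ := by
        congr 1
        rw [← Real.rpow_neg_one, ← Real.rpow_add hxpos]
        congr 1
        ring

/-- The exponent `d + 1/2` exceeds the rank of `L`, so the perturbation estimate is summable over
the lattice. -/
theorem exists_summable_coneTerm_sub (L : Submodule ℤ (mixedSpace K)) [DiscreteTopology L]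
    [IsZLattice ℝ L] (β : mixedSpace K) :
    ∃ u : L → ℝ, Summable u ∧ ∀ᶠ x : L in cofinite,
      ∀ s ∈ Metric.ball (1 : ℂ) (1 / (2 * finrank ℚ K)),
        ‖coneTerm ((x : mixedSpace K) + β) s - coneTerm (x : mixedSpace K) s‖ ≤ u x := by
  obtain ⟨R, C, hR, hC, h⟩ := exists_norm_coneTerm_sub_le K (norm_nonneg β)
  set p : ℝ := (finrank ℚ K : ℝ) + 1 / 2 with hp
  have hr : -p < -(finrank ℤ L : ℝ) := by
    rw [ZLattice.rank ℝ L, mixedEmbedding.finrank, hp]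
    linarith
  -- The perturbation estimate starts from a point of the support. If only `x + β` lies there, the
  -- roles are exchanged, and `‖x + β‖ ≥ ‖x‖ / 2` costs the factor `2 ^ p`.
  refine ⟨fun x => C * 2 ^ p * ‖x‖ ^ (-p), (ZLattice.summable_norm_rpow L _ hr).mul_left _, ?_⟩
  have hfin : ∀ᶠ x : L in cofinite, 2 * R + 2 * ‖β‖ < ‖x‖ := by
    have h1 : (Metric.closedBall (0 : mixedSpace K) (2 * R + 2 * ‖β‖) ∩
        (L : Set (mixedSpace K))).Finite :=
      Metric.finite_isBounded_inter_isClosed ⟨inferInstance⟩ Metric.isBounded_closedBall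
        (AddSubgroup.isClosed_of_discrete (H := L.toAddSubgroup))
    refine (h1.preimage (f := ((↑) : L → mixedSpace K)) Subtype.val_injective.injOn).subset ?_
    intro x hx
    simpa using hx
  filter_upwards [hfin] with x hx s hs
  have hnx : (‖x‖ : ℝ) = ‖(x : mixedSpace K)‖ := rfl
  have hβ := norm_nonneg β
  have hle' : ‖(x : mixedSpace K) + β - x‖ ≤ ‖β‖ := by rw [add_sub_cancel_left]
  have hle : ‖(x : mixedSpace K) - (x + β)‖ ≤ ‖β‖ := by rwa [norm_sub_rev]
  have h2p : 1 ≤ (2 : ℝ) ^ p := Real.one_le_rpow (by norm_num) (by positivity)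
  have hx0 : 0 ≤ ‖x‖ ^ (-p) := Real.rpow_nonneg (norm_nonneg _) _
  by_cases h1 : coneWeight (x : mixedSpace K) = 0
  · by_cases h2 : coneWeight ((x : mixedSpace K) + β) = 0
    · rw [coneTerm_eq_zero h1, coneTerm_eq_zero h2, sub_zero, norm_zero]
      positivity
    · have h3 : ‖(x : mixedSpace K)‖ / 2 ≤ ‖(x : mixedSpace K) + β‖ := by
        have := norm_sub_le ((x : mixedSpace K) + β) β
        rw [add_sub_cancel_right] at this
        linarith
      rw [norm_sub_rev]
      refine (h ((x : mixedSpace K) + β) x h2 (by linarith) hle s hs).trans ?_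
      rw [mul_assoc]
      refine mul_le_mul_of_nonneg_left ?_ hC
      calc ‖(x : mixedSpace K) + β‖ ^ (-p) ≤ (‖x‖ / 2) ^ (-p) :=
            Real.rpow_le_rpow_of_nonpos (by linarith) h3 (by rw [hp]; linarith)
        _ = 2 ^ p * ‖x‖ ^ (-p) := by
            rw [Real.div_rpow (norm_nonneg _) (by norm_num), Real.rpow_neg (by norm_num : (0:ℝ) ≤ 2)]
            field_simp
  · refine (h x ((x : mixedSpace K) + β) h1 (by linarith) hle' s hs).trans ?_
    refine mul_le_mul_of_nonneg_right ?_ hx0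
    exact le_mul_of_one_le_right hC h2p

/-- Continuation of the weighted lattice sum. -/
theorem exists_differentiableOn_coneTerm_sum (L : Submodule ℤ (mixedSpace K)) [DiscreteTopology L]
    [IsZLattice ℝ L] :
    ∃ H : ℂ → ℂ, DifferentiableOn ℂ H (Metric.ball 1 (1 / (2 * finrank ℚ K))) ∧
      ∀ s ∈ Metric.ball (1 : ℂ) (1 / (2 * finrank ℚ K)), 1 < s.re →
        ((2 : ℂ) ^ (finrank ℚ K * s) - 2 ^ finrank ℚ K) *
          ∑' x : L, coneTerm (x : mixedSpace K) s = H s := by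
  have hfree : Module.Free ℤ L := ZLattice.module_free ℝ L
  have hfin : Module.Finite ℤ L := ZLattice.module_finite ℝ L
  have hrank : finrank ℤ L = finrank ℚ K := by
    rw [ZLattice.rank ℝ L, mixedEmbedding.finrank]
  have hcard : Fintype.card (Fin (finrank ℤ L)) = finrank ℚ K := by rw [Fintype.card_fin, hrank]
  have := exists_differentiableOn_lattice_sum (Module.finBasis ℤ L) coneTerm
    (r := 1 / (2 * finrank ℚ K)) differentiable_coneTerm
    (by rw [hcard]; exact coneTerm_half_smul) (exists_summable_coneTerm_sub L)
    (fun s hs => (summable_coneTerm L hs).of_norm)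
  rwa [hcard] at this

end LegendreFactorial

end

/-! ### From lattice sums to sums over ideals -/

noncomputable section

namespace LegendreFactorial

open NumberField.InfinitePlace NumberField.mixedEmbedding NumberField.Units
  NumberField.Units.dirichletUnitTheorem Module
open scoped Classical nonZeroDivisors

variable {K : Type*} [Field K] [NumberField K]

/-- Units as products of a root of unity and powers of fundamental units. -/
def unitsEquiv (K : Type*) [Field K] [NumberField K] :
    torsion K × (Fin (rank K) → ℤ) ≃ (𝓞 K)ˣ :=
  Equiv.ofBijective (fun p => p.1 * ∏ i, fundSystem K i ^ p.2 i) <| by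
    refine ⟨fun p q h => ?_, fun u => ?_⟩
    · exact (exist_unique_eq_mul_prod K _).unique rfl h
    · obtain ⟨p, hp, -⟩ := exist_unique_eq_mul_prod K u
      exact ⟨p, hp.symm⟩

theorem equivFun_logEmbedding_unitsEquiv (p : torsion K × (Fin (rank K) → ℤ)) (i : Fin (rank K)) :
    (unitBasis K).equivFun (logEmbedding K (Additive.ofMul (unitsEquiv K p))) i = p.2 i := by
  have h : logEmbedding K (Additive.ofMul (unitsEquiv K p)) =
      ∑ j, (p.2 j : ℝ) • unitBasis K j := by
    change logEmbedding K (Additive.ofMul (p.1 * ∏ i, fundSystem K i ^ p.2 i)) = _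
    rw [ofMul_mul, map_add, ofMul_prod, map_sum, (logEmbedding_eq_zero_iff).2 p.1.2, zero_add]
    refine Finset.sum_congr rfl fun j _ => ?_
    rw [ofMul_zpow, map_zsmul, logEmbedding_fundSystem, unitBasis, Basis.ofZLatticeBasis_apply,
      Int.cast_smul_eq_zsmul]
  rw [h, ← Basis.equivFun_symm_apply, LinearEquiv.apply_symm_apply]

/-- The weights of the unit multiples of a vector add up to the number of roots of unity. -/
theorem hasSum_coneWeight_unit_smul {x : mixedSpace K} (hx : mixedEmbedding.norm x ≠ 0) :
    HasSum (fun u : (𝓞 K)ˣ => coneWeight (u • x)) (torsionOrder K : ℝ) := by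
  rw [← (unitsEquiv K).hasSum_iff]
  refine hasSum_prod_of_nonneg (g := fun _ => 1) (fun _ => coneWeight_nonneg _) ?_ ?_
  · intro ζ
    -- A root of unity leaves the logarithmic coordinates fixed and the fundamental units translate
    -- them by `n`. So each root of unity contributes a full partition of unity.
    refine (funext fun n => ?_ : (fun n : Fin (rank K) → ℤ => _) = _) ▸
      hasSum_prod_tent ((unitBasis K).equivFun (logMap x))
    rw [Function.comp_apply, coneWeight, norm_unit_smul, if_neg hx,
      logMap_unit_smul _ hx, map_add]
    refine Finset.prod_congr rfl fun i _ => ?_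
    rw [Pi.add_apply, equivFun_logEmbedding_unitsEquiv, add_comm]
  · have := Fintype.ofFinite (torsion K)
    have h := hasSum_fintype (fun _ : torsion K => (1 : ℝ))
    rwa [Finset.sum_const, Finset.card_univ, ← Nat.card_eq_fintype_card, nsmul_eq_mul, mul_one] at h

theorem hasSum_coneTerm_unit_smul {x : mixedSpace K} (hx : mixedEmbedding.norm x ≠ 0) (s : ℂ) :
    HasSum (fun u : (𝓞 K)ˣ => coneTerm (u • x) s)
      ((torsionOrder K : ℂ) * ((mixedEmbedding.norm x : ℝ) : ℂ) ^ (-s)) := by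
  have h := ((hasSum_coneWeight_unit_smul hx).mapL Complex.ofRealCLM).mul_right
    (((mixedEmbedding.norm x : ℝ) : ℂ) ^ (-s))
  simp only [Complex.ofRealCLM_apply, Complex.ofReal_natCast] at h
  refine (funext fun u => ?_ : (fun u : (𝓞 K)ˣ => _) = _) ▸ h
  rw [coneTerm, norm_unit_smul]

theorem mixedEmbedding_norm_eq_absNorm (a : 𝓞 K) :
    mixedEmbedding.norm (mixedEmbedding K (a : K)) = (Ideal.absNorm (Ideal.span {a}) : ℝ) := by
  rw [Ideal.absNorm_span_singleton, Nat.cast_natAbs, ← Rat.cast_intCast, Int.cast_abs,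
    Algebra.coe_norm_int, ← norm_eq_norm]

variable (K) in
/-- The lattice of an integral ideal. -/
abbrev integralIdealLattice (J : (Ideal (𝓞 K))⁰) : Submodule ℤ (mixedSpace K) :=
  mixedEmbedding.idealLattice K (FractionalIdeal.mk0 K J)

theorem mem_integralIdealLattice {J : (Ideal (𝓞 K))⁰} {x : mixedSpace K} :
    x ∈ integralIdealLattice K J ↔ ∃ a : 𝓞 K, a ∈ (J : Ideal (𝓞 K)) ∧ mixedEmbedding K a = x := by
  rw [integralIdealLattice, mem_idealLattice]
  constructor
  · rintro ⟨y, hy, rfl⟩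
    rw [FractionalIdeal.coe_mk0, SetLike.mem_coe, FractionalIdeal.mem_coeIdeal] at hy
    obtain ⟨a, ha, rfl⟩ := hy
    exact ⟨a, ha, rfl⟩
  · rintro ⟨a, ha, rfl⟩
    refine ⟨a, ?_, rfl⟩
    rw [FractionalIdeal.coe_mk0, SetLike.mem_coe, FractionalIdeal.mem_coeIdeal]
    exact ⟨a, ha, rfl⟩

/-- Sums over a lattice `J` are sums over the ideals in the class inverse to that of `J`. -/
theorem hasSum_ideal_class {C : ClassGroup (𝓞 K)} {J : (Ideal (𝓞 K))⁰}
    (hJ : ClassGroup.mk0 J = C⁻¹) {s : ℂ} (hs : 1 < s.re) :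
    HasSum (fun I : {I : (Ideal (𝓞 K))⁰ // ClassGroup.mk0 I = C} => (torsionOrder K : ℂ) *
      ((Ideal.absNorm (I.1 : Ideal (𝓞 K)) * Ideal.absNorm (J : Ideal (𝓞 K)) : ℕ) : ℂ) ^ (-s))
      (∑' x : integralIdealLattice K J, coneTerm (x : mixedSpace K) s) := by
  have hprin : ∀ I : {I : (Ideal (𝓞 K))⁰ // ClassGroup.mk0 I = C},
      ∃ g : 𝓞 K, (I.1 : Ideal (𝓞 K)) * J = Ideal.span {g} := by
    intro I
    have h1 : ClassGroup.mk0 (I.1 * J) = 1 := by rw [map_mul, I.2, hJ, mul_inv_cancel]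
    have h2 : ((I.1 * J : (Ideal (𝓞 K))⁰) : Ideal (𝓞 K)).IsPrincipal :=
      (ClassGroup.mk0_eq_one_iff (I.1 * J).2).1 h1
    obtain ⟨g, hg⟩ := h2
    exact ⟨g, hg⟩
  choose g hg using hprin
  have hJ0 : (J : Ideal (𝓞 K)) ≠ 0 := nonZeroDivisors.coe_ne_zero J
  have hI0 : ∀ I : {I : (Ideal (𝓞 K))⁰ // ClassGroup.mk0 I = C}, (I.1 : Ideal (𝓞 K)) ≠ 0 :=
    fun I => nonZeroDivisors.coe_ne_zero I.1
  have hg0 : ∀ I, g I ≠ 0 := by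
    intro I h0
    have := hg I
    rw [h0, Ideal.span_singleton_eq_bot.2 rfl] at this
    exact mul_ne_zero (hI0 I) hJ0 this
  have hgJ : ∀ I, g I ∈ (J : Ideal (𝓞 K)) := by
    intro I
    have : Ideal.span {g I} ≤ (J : Ideal (𝓞 K)) := hg I ▸ Ideal.mul_le_right
    exact this (Ideal.mem_span_singleton_self _)
  -- For `I` in the class `C` the product `I J` is principal with generator `g I`. Conversely each
  -- nonzero `a ∈ J` determines `I = (a) / J`, and `a = u · g I` for a unique unit `u`.
  let ψ : {I : (Ideal (𝓞 K))⁰ // ClassGroup.mk0 I = C} × (𝓞 K)ˣ → integralIdealLattice K J :=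
    fun p => ⟨mixedEmbedding K ((p.2 * g p.1 : 𝓞 K) : K), mem_integralIdealLattice.2
      ⟨_, Ideal.mul_mem_left _ _ (hgJ p.1), rfl⟩⟩
  have hspan : ∀ (u : (𝓞 K)ˣ) (a : 𝓞 K), Ideal.span {(u * a : 𝓞 K)} = Ideal.span {a} := fun u a =>
    Ideal.span_singleton_mul_left_unit u.isUnit a
  have hψ : Function.Injective ψ := by
    rintro ⟨I, u⟩ ⟨I', u'⟩ h
    have h1 : (u * g I : 𝓞 K) = u' * g I' :=
      RingOfIntegers.coe_injective (mixedEmbedding_injective K (congrArg Subtype.val h))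
    have h2 : (I.1 : Ideal (𝓞 K)) * J = I'.1 * J := by
      rw [hg, hg, ← hspan u (g I), ← hspan u' (g I'), h1]
    have h3 : I = I' := Subtype.ext (Subtype.ext (mul_right_cancel₀ hJ0 h2))
    subst h3
    have h4 : u = u' := Units.ext (mul_right_cancel₀ (hg0 I) h1)
    rw [h4]
  have hoff : ∀ x ∉ Set.range ψ, coneTerm (x : mixedSpace K) s = 0 := by
    intro x hx
    obtain ⟨a, ha, hax⟩ := mem_integralIdealLattice.1 x.2
    by_cases ha0 : a = 0
    · refine coneTerm_eq_zero (by_contra fun h => norm_ne_zero_of_coneWeight_ne_zero h ?_) s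
      rw [← hax, ha0]
      simp
    · exfalso
      obtain ⟨I, hI⟩ := Ideal.dvd_iff_le.2 ((Ideal.span_singleton_le_iff_mem _).2 ha)
      have hI0 : I ≠ 0 := by
        rintro rfl
        rw [mul_zero] at hI
        exact ha0 (Ideal.span_singleton_eq_bot.1 hI)
      let I' : (Ideal (𝓞 K))⁰ := ⟨I, mem_nonZeroDivisors_of_ne_zero hI0⟩
      have hcl : ClassGroup.mk0 I' = C := by
        have h1 : ClassGroup.mk0 (J * I') = 1 := by
          rw [ClassGroup.mk0_eq_one_iff (SetLike.coe_mem _)]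
          exact ⟨⟨a, by simpa using hI.symm⟩⟩
        rw [map_mul, hJ, inv_mul_eq_one] at h1
        exact h1.symm
      have h2 : Ideal.span {g ⟨I', hcl⟩} = Ideal.span {a} := by
        rw [← hg, hI, mul_comm]
      obtain ⟨u, hu⟩ := Ideal.span_singleton_eq_span_singleton.1 h2
      refine hx ⟨(⟨I', hcl⟩, u), Subtype.ext ?_⟩
      rw [← hax, ← hu]
      simp only [ψ, mul_comm]
  have h1 := (hψ.hasSum_iff hoff).2 (summable_coneTerm (integralIdealLattice K J) hs).of_norm.hasSum
  refine h1.prod_fiberwise fun I => ?_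
  have hx0 : mixedEmbedding.norm (mixedEmbedding K (g I : K)) ≠ 0 := by
    rw [Ne, norm_eq_zero_iff' ⟨_, rfl⟩, map_eq_zero]
    exact_mod_cast hg0 I
  have h2 := hasSum_coneTerm_unit_smul hx0 s
  rw [mixedEmbedding_norm_eq_absNorm, ← hg, map_mul, Complex.ofReal_natCast] at h2
  refine (funext fun u => ?_ : (fun u : (𝓞 K)ˣ => _) = _) ▸ h2
  rw [Function.comp_apply, unitSMul_smul, ← map_mul]
  simp [ψ]

theorem absNorm_pos (I : (Ideal (𝓞 K))⁰) : 0 < Ideal.absNorm (I : Ideal (𝓞 K)) :=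
  Ideal.absNorm_pos_of_nonZeroDivisors I

/-- The sum over all ideals as a combination of lattice sums. -/
theorem hasSum_absNorm_cpow (J : ClassGroup (𝓞 K) → (Ideal (𝓞 K))⁰)
    (hJ : ∀ C, ClassGroup.mk0 (J C) = C⁻¹) {s : ℂ} (hs : 1 < s.re) :
    HasSum (fun I : (Ideal (𝓞 K))⁰ => (Ideal.absNorm (I : Ideal (𝓞 K)) : ℂ) ^ (-s))
      (∑ C, (torsionOrder K : ℂ)⁻¹ * (Ideal.absNorm (J C : Ideal (𝓞 K)) : ℂ) ^ s *
        ∑' x : integralIdealLattice K (J C), coneTerm (x : mixedSpace K) s) := by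
  have hclass : ∀ C, HasSum (Set.indicator {I : (Ideal (𝓞 K))⁰ | ClassGroup.mk0 I = C}
      fun I => (Ideal.absNorm (I : Ideal (𝓞 K)) : ℂ) ^ (-s))
      ((torsionOrder K : ℂ)⁻¹ * (Ideal.absNorm (J C : Ideal (𝓞 K)) : ℂ) ^ s *
        ∑' x : integralIdealLattice K (J C), coneTerm (x : mixedSpace K) s) := by
    intro C
    rw [← hasSum_subtype_iff_indicator]
    have h := (hasSum_ideal_class (hJ C) hs).mul_left
      ((torsionOrder K : ℂ)⁻¹ * (Ideal.absNorm (J C : Ideal (𝓞 K)) : ℂ) ^ s)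
    have h1 : (torsionOrder K : ℂ) ≠ 0 := by exact_mod_cast torsionOrder_ne_zero K
    have h2 : (Ideal.absNorm (J C : Ideal (𝓞 K)) : ℂ) ≠ 0 := by
      exact_mod_cast (absNorm_pos (J C)).ne'
    have h3 : (Ideal.absNorm (J C : Ideal (𝓞 K)) : ℂ) ^ s ≠ 0 := by
      rw [Complex.cpow_def_of_ne_zero h2]
      exact Complex.exp_ne_zero _
    have e : ∀ I : {I : (Ideal (𝓞 K))⁰ // ClassGroup.mk0 I = C},
        (torsionOrder K : ℂ)⁻¹ * (Ideal.absNorm (J C : Ideal (𝓞 K)) : ℂ) ^ s *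
          ((torsionOrder K : ℂ) * ((Ideal.absNorm (I.1 : Ideal (𝓞 K)) *
            Ideal.absNorm (J C : Ideal (𝓞 K)) : ℕ) : ℂ) ^ (-s)) =
        (Ideal.absNorm (I.1 : Ideal (𝓞 K)) : ℂ) ^ (-s) := by
      intro I
      rw [Nat.cast_mul, Complex.natCast_mul_natCast_cpow,
        Complex.cpow_neg (Ideal.absNorm (J C : Ideal (𝓞 K)) : ℂ)]
      field_simp
    simp only [e] at h
    exact h
  have := hasSum_sum fun C (_ : C ∈ Finset.univ) => hclass C
  refine (funext fun I => ?_ : (fun I : (Ideal (𝓞 K))⁰ => _) = _) ▸ this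
  simp [Set.indicator_apply]

theorem summable_norm_absNorm_cpow {s : ℂ} (hs : 1 < s.re) :
    Summable fun I : (Ideal (𝓞 K))⁰ => ‖(Ideal.absNorm (I : Ideal (𝓞 K)) : ℂ) ^ (-s)‖ := by
  choose J hJ using fun C : ClassGroup (𝓞 K) => ClassGroup.mk0_surjective C⁻¹
  exact (hasSum_absNorm_cpow J hJ hs).summable.norm

/-- Continuation of the sum over all ideals. -/
theorem exists_differentiableOn_ideal_sum (K : Type*) [Field K] [NumberField K] :
    ∃ H : ℂ → ℂ, DifferentiableOn ℂ H (Metric.ball 1 (1 / (2 * finrank ℚ K))) ∧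
      ∀ s ∈ Metric.ball (1 : ℂ) (1 / (2 * finrank ℚ K)), 1 < s.re →
        ((2 : ℂ) ^ (finrank ℚ K * s) - 2 ^ finrank ℚ K) *
          ∑' I : (Ideal (𝓞 K))⁰, (Ideal.absNorm (I : Ideal (𝓞 K)) : ℂ) ^ (-s) = H s := by
  choose J hJ using fun C : ClassGroup (𝓞 K) => ClassGroup.mk0_surjective C⁻¹
  choose H hH hHs using fun C => exists_differentiableOn_coneTerm_sum (integralIdealLattice K (J C))
  refine ⟨fun s => ∑ C, (torsionOrder K : ℂ)⁻¹ * (Ideal.absNorm (J C : Ideal (𝓞 K)) : ℂ) ^ s * H C s,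
    ?_, ?_⟩
  · refine DifferentiableOn.fun_sum fun C _ => DifferentiableOn.mul ?_ (hH C)
    have h2 : (Ideal.absNorm (J C : Ideal (𝓞 K)) : ℂ) ≠ 0 := by
      exact_mod_cast (absNorm_pos (J C)).ne'
    exact fun s _ => ((differentiableAt_id.const_cpow (Or.inl h2)).const_mul _).differentiableWithinAt
  · intro s hs h1
    rw [(hasSum_absNorm_cpow J hJ h1).tsum_eq, Finset.mul_sum]
    refine Finset.sum_congr rfl fun C _ => ?_
    rw [← hHs C s hs h1]
    ring

end LegendreFactorial

end

/-! ### The Dedekind zeta function near 1, and sums over prime powers -/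

noncomputable section

namespace LegendreFactorial

open Module
open scoped Classical nonZeroDivisors

variable {K : Type*} [Field K] [NumberField K]

variable (K) in
/-- The Dedekind zeta function as a sum over nonzero ideals. -/
def idealZeta (s : ℂ) : ℂ :=
  ∑' I : (Ideal (𝓞 K))⁰, (Ideal.absNorm (I : Ideal (𝓞 K)) : ℂ) ^ (-s)

theorem idealZeta_eq_dedekindZeta {s : ℂ} (hs : 1 < s.re) : idealZeta K s = dedekindZeta K s := by
  have h0 : s ≠ 0 := by rintro rfl; simp at hs; linarith
  have h1 := (summable_norm_absNorm_cpow (K := K) hs).of_norm.hasSum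
  rw [← (Equiv.sigmaFiberEquiv fun I : (Ideal (𝓞 K))⁰ =>
    Ideal.absNorm (I : Ideal (𝓞 K))).hasSum_iff] at h1
  rw [dedekindZeta, LSeries, idealZeta]
  refine (HasSum.tsum_eq (h1.sigma fun n => ?_)).symm
  have hfin : Finite {I : (Ideal (𝓞 K))⁰ // Ideal.absNorm (I : Ideal (𝓞 K)) = n} :=
    (Ideal.finite_setOfPred_absNorm_eq (S := 𝓞 K) n).to_subtype.of_injective
      (fun I => (⟨I.1, I.2⟩ : {I : Ideal (𝓞 K) | Ideal.absNorm I = n}))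
      (fun I J h => Subtype.ext (Subtype.ext (Subtype.mk.inj h)))
  have := Fintype.ofFinite {I : (Ideal (𝓞 K))⁰ // Ideal.absNorm (I : Ideal (𝓞 K)) = n}
  have h2 := hasSum_fintype (fun I : {I : (Ideal (𝓞 K))⁰ // Ideal.absNorm (I : Ideal (𝓞 K)) = n} =>
    (n : ℂ) ^ (-s))
  rw [Finset.sum_const, Finset.card_univ, ← Nat.card_eq_fintype_card, nsmul_eq_mul] at h2
  have h3 : LSeries.term (fun n => (Nat.card {I : Ideal (𝓞 K) // Ideal.absNorm I = n} : ℂ)) s n =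
      (Nat.card {I : (Ideal (𝓞 K))⁰ // Ideal.absNorm (I : Ideal (𝓞 K)) = n} : ℂ) *
        (n : ℂ) ^ (-s) := by
    -- The zero ideal is counted in the coefficient at `n = 0`, but the term there is 0 by
    -- convention, as is `0 ^ (-s)`.
    rcases eq_or_ne n 0 with rfl | hn
    · simp [Complex.zero_cpow (neg_ne_zero.2 h0)]
    · rw [LSeries.term_of_ne_zero hn, div_eq_mul_inv, Complex.cpow_neg]
      congr 2
      refine Nat.card_congr ⟨fun I => ⟨⟨I.1, ?_⟩, I.2⟩, fun I => ⟨I.1, I.2⟩, fun I => rfl,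
        fun I => rfl⟩
      refine mem_nonZeroDivisors_of_ne_zero fun h => hn ?_
      rw [← I.2, h]
      exact Ideal.absNorm_bot
  rw [h3]
  refine (funext fun I => ?_ : (fun I : {I : (Ideal (𝓞 K))⁰ //
    Ideal.absNorm (I : Ideal (𝓞 K)) = n} => _) = _) ▸ h2
  simp [Equiv.sigmaFiberEquiv, I.2]

theorem tendsto_sub_one_mul_idealZeta (K : Type*) [Field K] [NumberField K] :
    Tendsto (fun t : ℝ => ((t : ℂ) - 1) * idealZeta K t) (𝓝[>] 1)
      (𝓝 (dedekindZeta_residue K : ℂ)) := by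
  refine (tendsto_sub_one_mul_dedekindZeta_nhdsGT K).congr' ?_
  filter_upwards [self_mem_nhdsWithin] with t ht
  rw [idealZeta_eq_dedekindZeta (by simpa using ht)]

/-- Near `1` the function `(s - 1) ζ_K(s)` is analytic and does not vanish. -/
theorem exists_analyticAt_idealZeta (K : Type*) [Field K] [NumberField K] :
    ∃ h : ℂ → ℂ, AnalyticAt ℂ h 1 ∧ h 1 ≠ 0 ∧
      ∀ᶠ s in 𝓝 (1 : ℂ), 1 < s.re → (s - 1) * idealZeta K s = h s := by
  obtain ⟨H, hH, hHs⟩ := exists_differentiableOn_ideal_sum K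
  set d := finrank ℚ K with hd
  have hd0 : (d : ℂ) ≠ 0 := by exact_mod_cast (finrank_pos (R := ℚ) (M := K)).ne'
  have hr : 0 < 1 / (2 * d : ℝ) := by
    have : 0 < d := finrank_pos
    positivity
  have hball := Metric.ball_mem_nhds (1 : ℂ) hr
  have hHa : AnalyticAt ℂ H 1 := hH.analyticAt hball
  -- A simple zero at 1, with derivative `2^d · d · log 2`; its divided difference is what remains
  -- after removing the factor `s - 1`.
  let k : ℂ → ℂ := fun s => (2 : ℂ) ^ (d * s) - 2 ^ d
  have hkd : ∀ s : ℂ, HasDerivAt k ((2 : ℂ) ^ (d * s) * Complex.log 2 * d) s := by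
    intro s
    have h1 : HasDerivAt (fun s : ℂ => (d : ℂ) * s) d s := by
      simpa using (hasDerivAt_id s).const_mul (d : ℂ)
    exact (h1.const_cpow (Or.inl two_ne_zero)).sub_const _
  have hka : AnalyticAt ℂ k 1 :=
    (show Differentiable ℂ k from fun s => (hkd s).differentiableAt).analyticAt 1
  have hk1 : k 1 = 0 := by simp [k]
  obtain ⟨p, hp⟩ := hka
  have hκa : AnalyticAt ℂ (dslope k 1) 1 := ⟨_, hp.has_fpower_series_dslope_fslope⟩
  have hκ1 : dslope k 1 1 ≠ 0 := by
    rw [dslope_same, (hkd 1).deriv]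
    have h2 : Complex.log 2 ≠ 0 := by
      rw [← Complex.ofReal_ofNat, ← Complex.ofReal_log (by norm_num)]
      exact_mod_cast (Real.log_pos one_lt_two).ne'
    have h3 : (2 : ℂ) ^ ((d : ℂ) * 1) ≠ 0 := by simp
    exact mul_ne_zero (mul_ne_zero h3 h2) hd0
  have hks : ∀ s, k s = (s - 1) * dslope k 1 s := by
    intro s
    have := sub_smul_dslope k 1 s
    rw [hk1, sub_zero, smul_eq_mul] at this
    exact this.symm
  have hev : ∀ᶠ s in 𝓝 (1 : ℂ), 1 < s.re → (s - 1) * idealZeta K s = H s / dslope k 1 s := by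
    filter_upwards [hball, hκa.continuousAt.eventually_ne hκ1] with s hs hκ h1
    rw [eq_div_iff hκ, ← hHs s hs h1]
    change _ = k s * idealZeta K s
    rw [hks]
    ring
  have hha : AnalyticAt ℂ (fun s => H s / dslope k 1 s) 1 := hHa.div hκa hκ1
  refine ⟨fun s => H s / dslope k 1 s, hha, ?_, hev⟩
  -- By continuity the value at 1 is the one-sided real limit, that is, the nonzero residue of the
  -- class number formula.
  have htend : Tendsto (fun t : ℝ => (t : ℂ)) (𝓝[>] 1) (𝓝 (1 : ℂ)) :=
    (Complex.continuous_ofReal.tendsto' 1 1 (by simp)).mono_left nhdsWithin_le_nhds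
  have h1 := (hha.continuousAt.tendsto.comp htend)
  have h2 := (tendsto_sub_one_mul_idealZeta K).congr' (f₂ := (fun s => H s / dslope k 1 s) ∘
      fun t : ℝ => (t : ℂ)) (by
    filter_upwards [htend.eventually hev, self_mem_nhdsWithin] with t ht h
    exact ht (by simpa using h))
  change H 1 / dslope k 1 1 ≠ 0
  rw [tendsto_nhds_unique h1 h2]
  exact_mod_cast dedekindZeta_residue_ne_zero K

theorem log_le_rpow_div_cast {ε : ℝ} (n : ℕ) (hε : 0 < ε) : Real.log n ≤ (n : ℝ) ^ ε / ε :=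
  Real.log_le_rpow_div (Nat.cast_nonneg n) hε

/-- Termwise differentiation of the Dedekind zeta function. -/
theorem hasSum_deriv_idealZeta {s : ℂ} (hs : 1 < s.re) :
    DifferentiableAt ℂ (idealZeta K) s ∧
    HasSum (fun I : (Ideal (𝓞 K))⁰ => (Real.log (Ideal.absNorm (I : Ideal (𝓞 K))) : ℂ) *
      (Ideal.absNorm (I : Ideal (𝓞 K)) : ℂ) ^ (-s)) (-deriv (idealZeta K) s) := by
  obtain ⟨σ, h1, h2⟩ := exists_between hs
  have hu := summable_norm_absNorm_cpow (K := K) (s := (σ : ℂ)) (by simpa using h1)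
  have hU : IsOpen {s : ℂ | σ < s.re} := isOpen_lt continuous_const Complex.continuous_re
  have hne : ∀ I : (Ideal (𝓞 K))⁰, (Ideal.absNorm (I : Ideal (𝓞 K)) : ℂ) ≠ 0 := fun I => by
    exact_mod_cast (absNorm_pos I).ne'
  have hder : ∀ (I : (Ideal (𝓞 K))⁰) (s : ℂ), HasDerivAt
      (fun s => (Ideal.absNorm (I : Ideal (𝓞 K)) : ℂ) ^ (-s))
      (-((Real.log (Ideal.absNorm (I : Ideal (𝓞 K))) : ℂ) *
        (Ideal.absNorm (I : Ideal (𝓞 K)) : ℂ) ^ (-s))) s := by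
    intro I s
    convert (hasDerivAt_neg s).const_cpow (Or.inl (hne I)) using 1
    rw [← Complex.natCast_log]
    ring
  have hle : ∀ (I : (Ideal (𝓞 K))⁰) (w : ℂ), w ∈ {s : ℂ | σ < s.re} →
      ‖(Ideal.absNorm (I : Ideal (𝓞 K)) : ℂ) ^ (-w)‖ ≤
        ‖(Ideal.absNorm (I : Ideal (𝓞 K)) : ℂ) ^ (-(σ : ℂ))‖ := by
    intro I w hw
    rw [norm_natCast_cpow_neg (absNorm_pos I), norm_natCast_cpow_neg (absNorm_pos I),
      Complex.ofReal_re]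
    refine Real.rpow_le_rpow_of_exponent_le ?_ (by linarith [show σ < w.re from hw])
    exact_mod_cast absNorm_pos I
  have hd := Complex.differentiableOn_tsum_of_summable_norm hu
    (fun I s _ => (hder I s).differentiableAt.differentiableWithinAt) hU hle
  refine ⟨hd.differentiableAt (hU.mem_nhds h2), ?_⟩
  have h3 := (Complex.hasSum_deriv_of_summable_norm hu
    (fun I s _ => (hder I s).differentiableAt.differentiableWithinAt) hU hle h2).neg
  simp only [(hder _ s).deriv, neg_neg] at h3
  exact h3

/-- A prime as a nonzero ideal. -/
def primeIdeal (p : HeightOneSpectrum (𝓞 K)) : (Ideal (𝓞 K))⁰ :=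
  ⟨p.asIdeal, mem_nonZeroDivisors_of_ne_zero p.ne_bot⟩

theorem primeNorm_pos (p : HeightOneSpectrum (𝓞 K)) : 0 < primeNorm p := by
  have := two_le_primeNorm p
  omega

theorem log_primeNorm_nonneg (p : HeightOneSpectrum (𝓞 K)) : 0 ≤ Real.log (primeNorm p) :=
  Real.log_natCast_nonneg _

theorem summable_primeNorm_rpow {σ : ℝ} (hσ : 1 < σ) :
    Summable fun p : HeightOneSpectrum (𝓞 K) => (primeNorm p : ℝ) ^ (-σ) := by
  have h := summable_norm_absNorm_cpow (K := K) (s := (σ : ℂ)) (by simpa using hσ)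
  have hinj : Function.Injective (primeIdeal (K := K)) := fun p q h =>
    HeightOneSpectrum.ext (congrArg Subtype.val h)
  refine (h.comp_injective hinj).congr fun p => ?_
  rw [Function.comp_apply, norm_natCast_cpow_neg (absNorm_pos _), Complex.ofReal_re]
  rfl

theorem summable_log_mul_primeNorm_rpow {σ : ℝ} (hσ : 1 < σ) :
    Summable fun p : HeightOneSpectrum (𝓞 K) =>
      Real.log (primeNorm p) * (primeNorm p : ℝ) ^ (-σ) := by
  -- Half of the margin `σ - 1` pays for the logarithm; the other half keeps the exponent above 1.
  set ε := (σ - 1) / 2 with hε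
  have hε0 : 0 < ε := by rw [hε]; linarith
  have h1 : 1 < σ - ε := by rw [hε]; linarith
  refine Summable.of_nonneg_of_le (fun p => mul_nonneg (log_primeNorm_nonneg p) (by positivity))
    (fun p => ?_) ((summable_primeNorm_rpow (K := K) h1).mul_left (1 / ε))
  have hN : (0 : ℝ) < primeNorm p := by exact_mod_cast primeNorm_pos p
  calc _ ≤ (primeNorm p : ℝ) ^ ε / ε * (primeNorm p : ℝ) ^ (-σ) := by
        gcongr
        exact log_le_rpow_div_cast _ hε0
    _ = 1 / ε * ((primeNorm p : ℝ) ^ ε * (primeNorm p : ℝ) ^ (-σ)) := by ring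
    _ = _ := by
        rw [← Real.rpow_add hN]
        congr 2
        ring

theorem norm_primeNorm_cpow_lt_one (p : HeightOneSpectrum (𝓞 K)) {s : ℂ} (hs : 0 < s.re) :
    ‖(primeNorm p : ℂ) ^ (-s)‖ < 1 := by
  rw [norm_natCast_cpow_neg (primeNorm_pos p)]
  refine Real.rpow_lt_one_of_one_lt_of_neg ?_ (by linarith)
  exact_mod_cast two_le_primeNorm p

theorem primeNorm_rpow_le_half (p : HeightOneSpectrum (𝓞 K)) {σ : ℝ} (hs : 1 ≤ σ) :
    (primeNorm p : ℝ) ^ (-σ) ≤ 1 / 2 := by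
  have h2 : (2 : ℝ) ≤ primeNorm p := by exact_mod_cast two_le_primeNorm p
  calc (primeNorm p : ℝ) ^ (-σ) ≤ (2 : ℝ) ^ (-σ) :=
        Real.rpow_le_rpow_of_nonpos (by norm_num) h2 (by linarith)
    _ ≤ (2 : ℝ) ^ (-1 : ℝ) := Real.rpow_le_rpow_of_exponent_le (by norm_num) (by linarith)
    _ = 1 / 2 := by rw [Real.rpow_neg_one]; norm_num

/-- Summation of the geometric series over the powers of each prime. -/
theorem summable_prime_power_sum {P : Type*} {π : P → HeightOneSpectrum (𝓞 K)}
    (hπ : Function.Injective π) {F : P → ℕ} {c : ℝ} (hc : 0 < c)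
    (hF : ∀ p, c * primeNorm (π p) ≤ F p) {s : ℂ} (hs : 1 < s.re) :
    (Summable fun b : P × ℕ => ‖(Real.log (primeNorm (π b.1)) : ℂ) *
      ((F b.1 * primeNorm (π b.1) ^ b.2 : ℕ) : ℂ) ^ (-s)‖) ∧
    HasSum (fun p : P => (Real.log (primeNorm (π p)) : ℂ) * (F p : ℂ) ^ (-s) *
      (1 - (primeNorm (π p) : ℂ) ^ (-s))⁻¹)
      (∑' b : P × ℕ, (Real.log (primeNorm (π b.1)) : ℂ) *
        ((F b.1 * primeNorm (π b.1) ^ b.2 : ℕ) : ℂ) ^ (-s)) := by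
  have hN : ∀ p, (0 : ℝ) < primeNorm (π p) := fun p => by exact_mod_cast primeNorm_pos (π p)
  have hFpos : ∀ p, 0 < F p := fun p => by
    have : (0 : ℝ) < F p := lt_of_lt_of_le (mul_pos hc (hN p)) (hF p)
    exact_mod_cast this
  have hterm : ∀ b : P × ℕ, (Real.log (primeNorm (π b.1)) : ℂ) *
      ((F b.1 * primeNorm (π b.1) ^ b.2 : ℕ) : ℂ) ^ (-s) =
      (Real.log (primeNorm (π b.1)) : ℂ) * (F b.1 : ℂ) ^ (-s) *
        ((primeNorm (π b.1) : ℂ) ^ (-s)) ^ b.2 := by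
    intro b
    rw [Nat.cast_mul, Complex.natCast_mul_natCast_cpow, Nat.cast_pow,
      ← Complex.natCast_cpow_natCast_mul, mul_comm (b.2 : ℂ), Complex.cpow_mul_nat, mul_assoc]
  have hfib : ∀ p, HasSum (fun k : ℕ => (Real.log (primeNorm (π p)) : ℂ) *
      ((F p * primeNorm (π p) ^ k : ℕ) : ℂ) ^ (-s))
      ((Real.log (primeNorm (π p)) : ℂ) * (F p : ℂ) ^ (-s) *
      (1 - (primeNorm (π p) : ℂ) ^ (-s))⁻¹) := by
    intro p
    have h := (hasSum_geometric_of_norm_lt_one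
      (norm_primeNorm_cpow_lt_one (π p) (s := s) (by linarith))).mul_left
      ((Real.log (primeNorm (π p)) : ℂ) * (F p : ℂ) ^ (-s))
    exact (funext fun k => hterm (p, k) : (fun k : ℕ => (Real.log (primeNorm (π p)) : ℂ) *
      ((F p * primeNorm (π p) ^ k : ℕ) : ℂ) ^ (-s)) = _) ▸ h
  have hnorm : ∀ b : P × ℕ, ‖(Real.log (primeNorm (π b.1)) : ℂ) *
      ((F b.1 * primeNorm (π b.1) ^ b.2 : ℕ) : ℂ) ^ (-s)‖ =
      Real.log (primeNorm (π b.1)) * (F b.1 : ℝ) ^ (-s.re) *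
        ((primeNorm (π b.1) : ℝ) ^ (-s.re)) ^ b.2 := by
    intro b
    rw [hterm, norm_mul, norm_mul, norm_pow, norm_natCast_cpow_neg (hFpos _),
      norm_natCast_cpow_neg (primeNorm_pos _), Complex.norm_real,
      Real.norm_of_nonneg (log_primeNorm_nonneg _)]
  have hhalf : ∀ p, (primeNorm (π p) : ℝ) ^ (-s.re) ≤ 1 / 2 := fun p =>
    primeNorm_rpow_le_half (π p) hs.le
  have hsum : Summable fun b : P × ℕ => ‖(Real.log (primeNorm (π b.1)) : ℂ) *
      ((F b.1 * primeNorm (π b.1) ^ b.2 : ℕ) : ℂ) ^ (-s)‖ := by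
    simp_rw [hnorm]
    have hgeo : ∀ p, HasSum (fun k : ℕ => Real.log (primeNorm (π p)) * (F p : ℝ) ^ (-s.re) *
        ((primeNorm (π p) : ℝ) ^ (-s.re)) ^ k)
        (Real.log (primeNorm (π p)) * (F p : ℝ) ^ (-s.re) *
          (1 - (primeNorm (π p) : ℝ) ^ (-s.re))⁻¹) := fun p =>
      (hasSum_geometric_of_lt_one (by positivity) ((hhalf p).trans_lt (by norm_num))).mul_left _
    have hlog := fun p => log_primeNorm_nonneg (π p)
    rw [summable_prod_of_nonneg (fun b => mul_nonneg (mul_nonneg (hlog b.1) (by positivity))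
      (by positivity))]
    refine ⟨fun p => (hgeo p).summable, ?_⟩
    simp only [(hgeo _).tsum_eq]
    -- The 2 bounds a geometric series of ratio at most `1/2`; the power of `c` comes from `F p ≥ c
    -- Np`.
    refine Summable.of_nonneg_of_le (fun p => mul_nonneg (mul_nonneg (hlog p) (by positivity))
      (inv_nonneg.2 (by linarith [hhalf p]))) (fun p => ?_)
      (((summable_log_mul_primeNorm_rpow (K := K) hs).comp_injective hπ).mul_left
        (2 * c ^ (-s.re)))
    have h1 : (1 - (primeNorm (π p) : ℝ) ^ (-s.re))⁻¹ ≤ 2 := by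
      rw [inv_le_comm₀ (by linarith [hhalf p]) (by norm_num)]
      linarith [hhalf p]
    have h2 : (F p : ℝ) ^ (-s.re) ≤ c ^ (-s.re) * (primeNorm (π p) : ℝ) ^ (-s.re) := by
      rw [← Real.mul_rpow hc.le (hN p).le]
      exact Real.rpow_le_rpow_of_nonpos (mul_pos hc (hN p)) (hF p) (by linarith)
    calc _ ≤ Real.log (primeNorm (π p)) * (c ^ (-s.re) * (primeNorm (π p) : ℝ) ^ (-s.re)) * 2 :=
          mul_le_mul (mul_le_mul_of_nonneg_left h2 (hlog p)) h1
            (inv_nonneg.2 (by linarith [hhalf p])) (mul_nonneg (hlog p) (by positivity))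
      _ = _ := by simp only [Function.comp_apply]; ring
  exact ⟨hsum, hsum.of_norm.hasSum.prod_fiberwise hfib⟩

end LegendreFactorial

end

/-! ### The logarithmic derivative of the Dedekind zeta function -/

noncomputable section

namespace LegendreFactorial

open scoped Classical nonZeroDivisors

variable {K : Type*} [Field K] [NumberField K]

theorem absNorm_primeIdeal (p : HeightOneSpectrum (𝓞 K)) :
    Ideal.absNorm (primeIdeal p : Ideal (𝓞 K)) = primeNorm p := rfl

theorem primeIdeal_pow_dvd_iff (p : HeightOneSpectrum (𝓞 K)) (n : ℕ) (I : (Ideal (𝓞 K))⁰) :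
    primeIdeal p ^ n ∣ I ↔ n ≤ Multiset.count p.asIdeal
      (UniqueFactorizationMonoid.normalizedFactors (I : Ideal (𝓞 K))) := by
  have hI : (I : Ideal (𝓞 K)) ≠ 0 := nonZeroDivisors.ne_zero I.2
  have h1 : primeIdeal p ^ n ∣ I ↔ p.asIdeal ^ n ∣ (I : Ideal (𝓞 K)) := by
    refine ⟨fun ⟨J, hJ⟩ => ⟨J, by rw [hJ]; rfl⟩, fun ⟨J, hJ⟩ => ?_⟩
    refine ⟨⟨J, mem_nonZeroDivisors_of_ne_zero ?_⟩, Subtype.ext hJ⟩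
    rintro rfl
    exact hI (by rw [hJ, mul_zero])
  rw [h1, pow_dvd_iff_le_emultiplicity,
    UniqueFactorizationMonoid.emultiplicity_eq_count_normalizedFactors p.irreducible hI,
    normalize_eq, Nat.cast_le]

/-- The logarithm of the norm of an ideal is the sum of its von Mangoldt weights. -/
theorem hasSum_log_absNorm (I : (Ideal (𝓞 K))⁰) :
    HasSum (fun b : HeightOneSpectrum (𝓞 K) × ℕ =>
      if primeIdeal b.1 ^ (b.2 + 1) ∣ I then Real.log (primeNorm b.1) else 0)
      (Real.log (Ideal.absNorm (I : Ideal (𝓞 K)))) := by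
  have hI : (I : Ideal (𝓞 K)) ≠ 0 := nonZeroDivisors.ne_zero I.2
  let e : HeightOneSpectrum (𝓞 K) → ℕ := fun p => Multiset.count p.asIdeal
      (UniqueFactorizationMonoid.normalizedFactors (I : Ideal (𝓞 K)))
  have he : ∀ p : HeightOneSpectrum (𝓞 K), p.maxPowDividing (I : Ideal (𝓞 K)) =
      p.asIdeal ^ e p := fun p =>
    HeightOneSpectrum.maxPowDividing_eq_pow_multiset_count p hI
  have hlog : ∀ p : HeightOneSpectrum (𝓞 K), (e p : ℝ) * Real.log (primeNorm p) =
      Real.log (Ideal.absNorm (p.maxPowDividing (I : Ideal (𝓞 K)))) := fun p => by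
    rw [he, map_pow, Nat.cast_pow, Real.log_pow]
    rfl
  refine hasSum_prod_of_nonneg (g := fun p => (e p : ℝ) * Real.log (primeNorm p))
    (fun b => ?_) (fun p => ?_) ?_
  · split_ifs
    exacts [log_primeNorm_nonneg _, le_rfl]
  · have h : ∀ k ∉ Finset.range (e p), (if primeIdeal p ^ (k + 1) ∣ I then
        Real.log (primeNorm p) else 0) = 0 := fun k hk => by
      rw [primeIdeal_pow_dvd_iff, if_neg]
      simpa using hk
    have hsum : ∑ k ∈ Finset.range (e p), (if primeIdeal p ^ (k + 1) ∣ I then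
        Real.log (primeNorm p) else 0) = e p * Real.log (primeNorm p) := by
      rw [Finset.sum_congr rfl fun k hk => by
        rw [primeIdeal_pow_dvd_iff, if_pos (by simpa using hk)]]
      simp
    rw [← hsum]
    exact hasSum_sum_of_ne_finset_zero h
  · have hf : (Function.mulSupport fun p : HeightOneSpectrum (𝓞 K) =>
        p.maxPowDividing (I : Ideal (𝓞 K))).Finite := Ideal.hasFiniteMulSupport hI
    simp only [hlog]
    have h : ∀ p ∉ hf.toFinset, Real.log
        (Ideal.absNorm (p.maxPowDividing (I : Ideal (𝓞 K)))) = 0 := fun p hp => by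
      have : p.maxPowDividing (I : Ideal (𝓞 K)) = 1 := by
        rwa [Set.Finite.mem_toFinset, Function.notMem_mulSupport] at hp
      simp [this]
    have hsum : ∑ p ∈ hf.toFinset, Real.log
        (Ideal.absNorm (p.maxPowDividing (I : Ideal (𝓞 K)))) =
        Real.log (Ideal.absNorm (I : Ideal (𝓞 K))) := by
      rw [← Real.log_prod]
      · conv_rhs => rw [← Ideal.finprod_heightOneSpectrum_factorization hI,
          finprod_eq_prod _ hf, map_prod, Nat.cast_prod]
      · intro p _
        rw [he, map_pow]
        have := (primeNorm_pos p).ne'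
        exact_mod_cast pow_ne_zero _ this
    rw [← hsum]
    exact hasSum_sum_of_ne_finset_zero h

/-- The completely multiplicative function `I ↦ N(I) ^ (-s)`. -/
def absNormCpow (K : Type*) [Field K] [NumberField K] (s : ℂ) : (Ideal (𝓞 K))⁰ →* ℂ where
  toFun I := (Ideal.absNorm (I : Ideal (𝓞 K)) : ℂ) ^ (-s)
  map_one' := by simp
  map_mul' I J := by
    rw [Submonoid.coe_mul, map_mul, Nat.cast_mul, Complex.natCast_mul_natCast_cpow]

theorem absNormCpow_apply (s : ℂ) (I : (Ideal (𝓞 K))⁰) :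
    absNormCpow K s I = (Ideal.absNorm (I : Ideal (𝓞 K)) : ℂ) ^ (-s) := rfl

variable (K) in
/-- The negative logarithmic derivative of the Euler product of the Dedekind zeta function. -/
def primeSum (s : ℂ) : ℂ :=
  ∑' p : HeightOneSpectrum (𝓞 K), (Real.log (primeNorm p) : ℂ) * (primeNorm p : ℂ) ^ (-s) *
      (1 - (primeNorm p : ℂ) ^ (-s))⁻¹

theorem summable_primeSum {s : ℂ} (hs : 1 < s.re) :
    Summable fun p : HeightOneSpectrum (𝓞 K) => (Real.log (primeNorm p) : ℂ) *
      (primeNorm p : ℂ) ^ (-s) * (1 - (primeNorm p : ℂ) ^ (-s))⁻¹ :=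
  (summable_prime_power_sum (π := id) Function.injective_id (F := primeNorm) one_pos
    (fun _ => (one_mul _).le) hs).2.summable

/-- The identity `log N(I) = ∑_{p^k ∣ I, k ≥ 1} log Np`, fed into `hasSum_divisor_weights`, factors
`∑ log N(I) N(I)^(-s) = -ζ_K'(s)`. Neither the Euler product nor a logarithm of `ζ_K` is needed. -/
theorem primeSum_mul_idealZeta {s : ℂ} (hs : 1 < s.re) :
    primeSum K s * idealZeta K s = -deriv (idealZeta K) s := by
  -- The choice `F p = Np` makes the exponents start at 1: `F p · Np^k = Np^(k+1)`.
  obtain ⟨h1, h2⟩ := summable_prime_power_sum (π := id) (Function.injective_id)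
    (F := primeNorm (K := K)) one_pos (fun p => (one_mul _).le) hs
  have hd : ∀ b : HeightOneSpectrum (𝓞 K) × ℕ,
      absNormCpow K s (primeIdeal b.1 ^ (b.2 + 1)) =
        ((primeNorm b.1 * primeNorm b.1 ^ b.2 : ℕ) : ℂ) ^ (-s) := by
    intro b
    rw [absNormCpow_apply, SubmonoidClass.coe_pow, map_pow, pow_succ', absNorm_primeIdeal]
  have hW : ∀ I : (Ideal (𝓞 K))⁰, HasSum (fun b : HeightOneSpectrum (𝓞 K) × ℕ =>
      if primeIdeal b.1 ^ (b.2 + 1) ∣ I then (Real.log (primeNorm b.1) : ℂ) else 0)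
      (Real.log (Ideal.absNorm (I : Ideal (𝓞 K))) : ℂ) := by
    intro I
    have := (hasSum_log_absNorm I).mapL Complex.ofRealCLM
    refine (funext fun b => ?_ : (fun b : HeightOneSpectrum (𝓞 K) × ℕ => _) = _) ▸ this
    simp only [Complex.ofRealCLM_apply]
    split_ifs <;> simp
  have hχ : Summable fun I => ‖absNormCpow K s I‖ := summable_norm_absNorm_cpow hs
  have hL : Summable fun b : HeightOneSpectrum (𝓞 K) × ℕ =>
      ‖(Real.log (primeNorm b.1) : ℂ) * absNormCpow K s (primeIdeal b.1 ^ (b.2 + 1))‖ := by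
    simp only [hd]
    exact h1
  have : IsCancelMul (Ideal (𝓞 K))⁰ := by
    have h : IsLeftCancelMul (Ideal (𝓞 K))⁰ := ⟨fun I J L h => Subtype.ext
      (mul_left_cancel₀ (nonZeroDivisors.ne_zero I.2) (congrArg Subtype.val h))⟩
    exact CommMagma.IsLeftCancelMul.toIsCancelMul _
  have h4 := (hasSum_divisor_weights (absNormCpow K s)
    (fun b : HeightOneSpectrum (𝓞 K) × ℕ => primeIdeal b.1 ^ (b.2 + 1))
    (fun b => (Real.log (primeNorm b.1) : ℂ)) hχ hL
    (fun I => (Real.log (Ideal.absNorm (I : Ideal (𝓞 K))) : ℂ)) hW).2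
  simp only [hd, absNormCpow_apply] at h4
  have h5 : primeSum K s = ∑' b : HeightOneSpectrum (𝓞 K) × ℕ,
      (Real.log (primeNorm b.1) : ℂ) *
        ((primeNorm b.1 * primeNorm b.1 ^ b.2 : ℕ) : ℂ) ^ (-s) := h2.tsum_eq
  rw [h5, idealZeta]
  exact h4.unique (hasSum_deriv_idealZeta hs).2

/-- The sum over primes has a simple pole with residue `1` at `1`. -/
theorem exists_analyticAt_primeSum (K : Type*) [Field K] [NumberField K] :
    ∃ P : ℂ → ℂ, AnalyticAt ℂ P 1 ∧ P 1 = 1 ∧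
      ∀ᶠ s in 𝓝 (1 : ℂ), 1 < s.re → (s - 1) * primeSum K s = P s := by
  obtain ⟨h, hh, h1, hev⟩ := exists_analyticAt_idealZeta K
  -- With `h = (s - 1) ζ_K` one has `-ζ_K'/ζ_K = 1/(s - 1) - h'/h`.
  refine ⟨fun s => 1 - (s - 1) * deriv h s / h s, ?_, by simp, ?_⟩
  · exact analyticAt_const.sub
      (((analyticAt_id.sub analyticAt_const).mul hh.deriv).div hh h1)
  filter_upwards [hev.eventually_nhds, hh.continuousAt.eventually_ne h1] with s hs hne hre
  have hopen : ∀ᶠ w in 𝓝 s, 1 < w.re :=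
    (isOpen_lt continuous_const Complex.continuous_re).mem_nhds hre
  have heq : (fun w => (w - 1) * idealZeta K w) =ᶠ[𝓝 s] h := by
    filter_upwards [hs, hopen] with w hw hw1 using hw hw1
  have hζ := (hasSum_deriv_idealZeta (K := K) hre).1.hasDerivAt
  have hder := (((hasDerivAt_id s).sub_const 1).mul hζ).deriv
  have e1 : deriv h s = idealZeta K s + (s - 1) * deriv (idealZeta K) s := by
    rw [← heq.deriv_eq]
    rw [show (fun w => (w - 1) * idealZeta K w) = (fun w => w - 1) * idealZeta K from rfl]
    simpa using hder
  have e2 : (s - 1) * idealZeta K s = h s := heq.eq_of_nhds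
  have e3 := primeSum_mul_idealZeta (K := K) hre
  have key : (s - 1) * primeSum K s * h s = h s - (s - 1) * deriv h s := by
    rw [e1, ← e2]
    linear_combination (s - 1) ^ 2 * e3
  rw [eq_sub_iff_add_eq, ← mul_left_inj' hne, add_mul, key, div_mul_cancel₀ _ hne]
  ring

/-- `(s - 1) ζ(s)` is analytic at `1`. -/
theorem exists_analyticAt_riemannZeta : ∃ Z : ℂ → ℂ, AnalyticAt ℂ Z 1 ∧ Z 1 = 1 ∧
    ∀ s, s ≠ 1 → Z s = (s - 1) * riemannZeta s := by
  refine ⟨Function.update (fun s => (s - 1) * riemannZeta s) 1 1, ?_, by simp,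
    fun s hs => Function.update_of_ne hs _ _⟩
  refine Complex.analyticAt_of_differentiable_on_punctured_nhds_of_continuousAt ?_ ?_
  · filter_upwards [self_mem_nhdsWithin] with s hs
    have : Function.update (fun s => (s - 1) * riemannZeta s) 1 1 =ᶠ[𝓝 s]
        fun s => (s - 1) * riemannZeta s := by
      filter_upwards [isOpen_compl_singleton.mem_nhds hs] with w hw
      exact Function.update_of_ne hw _ _
    rw [this.differentiableAt_iff]
    exact (differentiableAt_id.sub_const 1).mul (differentiableAt_riemannZeta hs)
  · rw [continuousAt_update_same]
    exact riemannZeta_residue_one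

theorem tendsto_primeNorm : Tendsto (primeNorm (K := K)) cofinite atTop := by
  refine tendsto_atTop.2 fun n => ?_
  refine (finite_setOf_primeNorm_le (K := K) n).subset fun p hp => ?_
  exact (not_le.1 (show ¬ n ≤ primeNorm p from hp)).le

end LegendreFactorial

end

/-! ### Comparison of `f(p)` with `c Np` -/

noncomputable section

namespace LegendreFactorial

open scoped Classical

variable {K : Type*} [Field K] [NumberField K] {S : Finset (HeightOneSpectrum (𝓞 K))}

theorem abs_log_one_add_le {x : ℝ} (hx : |x| ≤ 1 / 2) : |Real.log (1 + x)| ≤ 2 * |x| := by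
  obtain ⟨h1, h2⟩ := abs_le.1 hx
  have hpos : 0 < 1 + x := by linarith
  have hu := Real.log_le_sub_one_of_pos hpos
  have hl := Real.one_sub_inv_le_log_of_pos hpos
  have hl' : -(2 * |x|) ≤ 1 - (1 + x)⁻¹ := by
    have h3 : 1 - (1 + x)⁻¹ = x * (1 + x)⁻¹ := by field_simp; ring
    have h4 : (1 + x)⁻¹ ≤ 2 := by
      rw [inv_le_comm₀ hpos (by norm_num)]
      linarith
    have h5 : |x * (1 + x)⁻¹| ≤ |x| * 2 := by
      rw [abs_mul, abs_of_pos (inv_pos.2 hpos)]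
      gcongr
    rw [h3]
    linarith [neg_abs_le (x * (1 + x)⁻¹)]
  rw [abs_le]
  constructor
  · linarith
  · linarith [le_abs_self x, abs_nonneg x]

/-- Comparison of complex powers of two nearby positive reals. -/
theorem norm_cpow_neg_sub_cpow_neg_le {a b : ℝ} (ha : 0 < a) (hb : 0 < b) {s : ℂ}
    (h : ‖s‖ * |Real.log (a / b)| ≤ 1) :
    ‖(a : ℂ) ^ (-s) - (b : ℂ) ^ (-s)‖ ≤ 2 * (‖s‖ * |Real.log (a / b)|) * b ^ (-s.re) := by
  have h1 : ((a / b : ℝ) : ℂ) ^ (-s) = Complex.exp (-s * (Real.log (a / b) : ℂ)) := by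
    rw [Complex.cpow_def_of_ne_zero (by exact_mod_cast (div_pos ha hb).ne'),
      Complex.ofReal_log (div_pos ha hb).le, mul_comm]
  have h2 : (a : ℂ) ^ (-s) - (b : ℂ) ^ (-s) =
      (Complex.exp (-s * (Real.log (a / b) : ℂ)) - 1) * (b : ℂ) ^ (-s) := by
    rw [← h1, sub_mul, one_mul, ← Complex.mul_cpow_ofReal_nonneg (div_pos ha hb).le hb.le,
      ← Complex.ofReal_mul, div_mul_cancel₀ _ hb.ne']
  have h3 : ‖-s * (Real.log (a / b) : ℂ)‖ = ‖s‖ * |Real.log (a / b)| := by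
    rw [norm_mul, norm_neg, Complex.norm_real, Real.norm_eq_abs]
  rw [h2, norm_mul, Complex.norm_cpow_eq_rpow_re_of_pos hb, Complex.neg_re, ← h3]
  exact mul_le_mul_of_nonneg_right (Complex.norm_exp_sub_one_le (by rwa [h3])) (by positivity)

section

variable {f : PrimesOutside S → ℕ+} {c δ : ℝ}

/-- After division by `c Np` the hypothesis says that the ratio is `1 + x` with `|x| ≤ (M/c)
Np^(-δ)`, which is at most `1/2` for all but finitely many `p`. -/
theorem eventually_abs_log_le (hc : 0 < c) (hδ : 0 < δ) {M : ℝ}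
    (hf : ∀ p : PrimesOutside S, |((f p : ℕ) : ℝ) - c * (primeNorm p.1 : ℝ)| ≤
      M * (primeNorm p.1 : ℝ) ^ (1 - δ)) :
    ∀ᶠ p : PrimesOutside S in cofinite, c / 2 * primeNorm p.1 ≤ (f p : ℕ) ∧
      |Real.log ((f p : ℕ) / (c * primeNorm p.1))| ≤
        2 * (M / c * (primeNorm p.1 : ℝ) ^ (-δ)) := by
  have ht : Tendsto (fun p : PrimesOutside S => (primeNorm p.1 : ℝ)) cofinite atTop :=
    tendsto_natCast_atTop_atTop.comp (tendsto_primeNorm.comp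
      Subtype.val_injective.tendsto_cofinite)
  have h0 : Tendsto (fun p : PrimesOutside S => M / c * (primeNorm p.1 : ℝ) ^ (-δ)) cofinite
      (𝓝 0) := by
    simpa using ((tendsto_rpow_neg_atTop hδ).comp ht).const_mul (M / c)
  filter_upwards [h0.eventually_le_const (by norm_num : (0 : ℝ) < 1 / 2)] with p hp
  have hN : (0 : ℝ) < primeNorm p.1 := by exact_mod_cast primeNorm_pos p.1
  have hcN := mul_pos hc hN
  set x : ℝ := ((f p : ℕ) : ℝ) / (c * primeNorm p.1) - 1 with hx
  have hxle : |x| ≤ M / c * (primeNorm p.1 : ℝ) ^ (-δ) := by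
    rw [hx, div_sub_one hcN.ne', abs_div, abs_of_pos hcN, div_le_iff₀ hcN]
    refine (hf p).trans_eq ?_
    rw [sub_eq_add_neg, Real.rpow_add hN, Real.rpow_one]
    field_simp
  have hx1 : ((f p : ℕ) : ℝ) / (c * primeNorm p.1) = 1 + x := by rw [hx]; ring
  refine ⟨?_, ?_⟩
  · have h1 := neg_abs_le x
    have h2 : 1 / 2 ≤ ((f p : ℕ) : ℝ) / (c * primeNorm p.1) := by rw [hx1]; linarith
    rw [le_div_iff₀ hcN] at h2
    linarith
  · rw [hx1]
    exact (abs_log_one_add_le (hxle.trans hp)).trans (by linarith)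

/-- The finitely many exceptional primes only lower the constant, because `f` is positive. -/
theorem exists_mul_primeNorm_le
    (h : ∃ b > (0 : ℝ), ∀ᶠ p : PrimesOutside S in cofinite, b * primeNorm p.1 ≤ (f p : ℕ)) :
    ∃ b : ℝ, 0 < b ∧ ∀ p : PrimesOutside S, b * primeNorm p.1 ≤ (f p : ℕ) := by
  obtain ⟨b, hb, h⟩ := h
  have hF : ∀ p, (0 : ℝ) < (f p : ℕ) := fun p => by exact_mod_cast (f p).pos
  have hbdd : BddAbove (Set.range fun p : PrimesOutside S =>
      (primeNorm p.1 : ℝ) / (f p : ℕ)) := by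
    refine IsBoundedUnder.bddAbove_range_of_cofinite ⟨1 / b, ?_⟩
    rw [eventually_map]
    filter_upwards [h] with p hp
    rw [div_le_div_iff₀ (hF p) hb]
    linarith
  obtain ⟨B, hB⟩ := hbdd
  -- The maximum with 1 keeps the constant positive without knowing that there is a prime outside
  -- `S`.
  refine ⟨1 / max B 1, by positivity, fun p => ?_⟩
  have h1 := (hB ⟨p, rfl⟩).trans (le_max_left B 1)
  rw [div_le_iff₀ (hF p)] at h1
  rw [div_mul_eq_mul_div, one_mul, div_le_iff₀ (by positivity), mul_comm]
  exact h1

theorem finite_setOf_le {b : ℝ} (hb : 0 < b)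
    (h : ∀ p : PrimesOutside S, b * primeNorm p.1 ≤ (f p : ℕ)) (n : ℕ) :
    {p | (f p : ℕ) ≤ n}.Finite := by
  refine ((finite_setOf_primeNorm_le (K := K) ⌊(n : ℝ) / b⌋₊).preimage
    (Subtype.val_injective (p := fun p => p ∉ S)).injOn).subset fun p hp => ?_
  refine Nat.le_floor ((le_div_iff₀ hb).2 ?_)
  rw [mul_comm]
  exact (h p).trans (by exact_mod_cast hp)

/-- The error made by replacing `f(p)` with `c N(p)`. -/
def comparisonTerm (f : PrimesOutside S → ℕ+) (c : ℝ) (p : PrimesOutside S) (s : ℂ) : ℂ :=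
  (Real.log (primeNorm p.1) : ℂ) *
    ((((f p : ℕ) : ℝ) : ℂ) ^ (-s) - ((c * primeNorm p.1 : ℝ) : ℂ) ^ (-s)) *
      (1 - (primeNorm p.1 : ℂ) ^ (-s))⁻¹

theorem one_sub_primeNorm_cpow_ne_zero (p : HeightOneSpectrum (𝓞 K)) {s : ℂ} (hs : 0 < s.re) :
    1 - (primeNorm p : ℂ) ^ (-s) ≠ 0 := by
  intro h
  have := norm_primeNorm_cpow_lt_one p hs
  rw [← sub_eq_zero.1 h, norm_one] at this
  exact lt_irrefl _ this

theorem differentiableAt_cpow_neg {a : ℂ} (ha : a ≠ 0) (s : ℂ) :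
    DifferentiableAt ℂ (fun s : ℂ => a ^ (-s)) s :=
  differentiableAt_id.neg.const_cpow (Or.inl ha)

theorem differentiableAt_primeFactor (p : HeightOneSpectrum (𝓞 K)) {s : ℂ} (hs : 0 < s.re) :
    DifferentiableAt ℂ (fun s : ℂ => (1 - (primeNorm p : ℂ) ^ (-s))⁻¹) s :=
  ((differentiableAt_const _).sub (differentiableAt_cpow_neg
    (by exact_mod_cast (primeNorm_pos p).ne') s)).inv (one_sub_primeNorm_cpow_ne_zero p hs)

theorem differentiableAt_comparisonTerm (hc : 0 < c) (p : PrimesOutside S) {s : ℂ}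
    (hs : 0 < s.re) : DifferentiableAt ℂ (comparisonTerm f c p) s := by
  have h1 : (((f p : ℕ) : ℝ) : ℂ) ≠ 0 := by exact_mod_cast (f p).ne_zero
  have h2 : ((c * primeNorm p.1 : ℝ) : ℂ) ≠ 0 := by
    have : (0 : ℝ) < primeNorm p.1 := by exact_mod_cast primeNorm_pos p.1
    exact_mod_cast (mul_pos hc this).ne'
  exact (((differentiableAt_cpow_neg h1 s).sub (differentiableAt_cpow_neg h2 s)).const_mul _).mul
    (differentiableAt_primeFactor p.1 hs)

/-- The relative error `Np^(-δ)` moves the abscissa of convergence to the left of 1. -/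
theorem analyticAt_tsum_comparisonTerm (hc : 0 < c) (hδ : 0 < δ) {M : ℝ}
    (hf : ∀ p : PrimesOutside S, |((f p : ℕ) : ℝ) - c * (primeNorm p.1 : ℝ)| ≤
      M * (primeNorm p.1 : ℝ) ^ (1 - δ)) :
    AnalyticAt ℂ (fun s => ∑' p, comparisonTerm f c p s) 1 := by
  -- `ρ ≤ δ/2` makes the exponent `1 - ρ + δ` exceed 1; `ρ ≤ 1/2` gives `Re s ≥ 1/2` and `‖s‖ ≤ 2`
  -- on the disc.
  set ρ : ℝ := min (δ / 2) (1 / 2) with hρ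
  have hρ0 : 0 < ρ := lt_min (by linarith) (by norm_num)
  have hρ1 : ρ ≤ 1 / 2 := min_le_right _ _
  have hρδ : ρ ≤ δ / 2 := min_le_left _ _
  have hM : ∀ p : PrimesOutside S, 0 ≤ M := fun p => by
    have h1 : (0 : ℝ) < primeNorm p.1 := by exact_mod_cast primeNorm_pos p.1
    exact nonneg_of_mul_nonneg_left ((abs_nonneg _).trans (hf p)) (by positivity)
  have hmem : ∀ s ∈ Metric.closedBall (1 : ℂ) ρ, 1 - ρ ≤ s.re ∧ s.re ≤ 2 ∧ ‖s‖ ≤ 2 := by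
    intro s hs
    rw [Metric.mem_closedBall, dist_eq_norm] at hs
    have h1 := abs_le.1 ((Complex.abs_re_le_norm (s - 1)).trans hs)
    simp only [Complex.sub_re, Complex.one_re] at h1
    have h2 := norm_add_le (s - 1) 1
    rw [sub_add_cancel, norm_one] at h2
    exact ⟨by linarith, by linarith, by linarith⟩
  -- `16 = 2 · 4 · 2`: the estimate for `exp z - 1`, the bound for `‖s‖ |log (f(p) / (c Np))|`, and
  -- the geometric factor. The exponential bounds `c^(-Re s)`.
  have hu : Summable fun p : PrimesOutside S => (16 * (M / c) * Real.exp (2 * |Real.log c|)) *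
      (Real.log (primeNorm p.1) * (primeNorm p.1 : ℝ) ^ (-(1 - ρ + δ))) :=
    ((summable_log_mul_primeNorm_rpow (K := K) (by linarith)).comp_injective
      Subtype.val_injective).mul_left _
  have hdiff : ∀ p : PrimesOutside S,
      DifferentiableOn ℂ (comparisonTerm f c p) (Metric.closedBall 1 ρ) := fun p s hs =>
    (differentiableAt_comparisonTerm hc p
      (by linarith [(hmem s hs).1])).differentiableWithinAt
  refine (differentiableOn_tsum_of_eventually_norm_le hdiff hu ?_).analyticAt
    (Metric.ball_mem_nhds 1 hρ0)
  have ht : Tendsto (fun p : PrimesOutside S => (primeNorm p.1 : ℝ)) cofinite atTop :=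
    tendsto_natCast_atTop_atTop.comp (tendsto_primeNorm.comp
      Subtype.val_injective.tendsto_cofinite)
  have h0 : Tendsto (fun p : PrimesOutside S => M / c * (primeNorm p.1 : ℝ) ^ (-δ)) cofinite
      (𝓝 0) := by
    simpa using ((tendsto_rpow_neg_atTop hδ).comp ht).const_mul (M / c)
  -- `Np ≥ 4` and `Re s ≥ 1/2` give `Np^(-Re s) ≤ 1/2`; the threshold `1/4` gives `‖s‖ |log (f(p) /
  -- (c Np))| ≤ 1`.
  filter_upwards [eventually_abs_log_le hc hδ hf, ht.eventually_ge_atTop 4,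
    h0.eventually_le_const (by norm_num : (0 : ℝ) < 1 / 4)] with p hlog hp4 hsmall s hs
  obtain ⟨hs1, hs2, hs3⟩ := hmem s (Metric.ball_subset_closedBall hs)
  have hN : (0 : ℝ) < primeNorm p.1 := by linarith
  have hF : (0 : ℝ) < ((f p : ℕ) : ℝ) := by exact_mod_cast (f p).pos
  have hcN := mul_pos hc hN
  set N : ℝ := (primeNorm p.1 : ℝ)
  set t : ℝ := |Real.log (((f p : ℕ) : ℝ) / (c * N))|
  have ht0 : 0 ≤ t := abs_nonneg _
  have hst : ‖s‖ * t ≤ 4 * (M / c * N ^ (-δ)) := by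
    calc ‖s‖ * t ≤ 2 * (2 * (M / c * N ^ (-δ))) :=
          mul_le_mul hs3 hlog.2 ht0 (by norm_num)
      _ = _ := by ring
  have hdif := norm_cpow_neg_sub_cpow_neg_le hF hcN (s := s) (hst.trans (by linarith))
  have hcpow : (c * N) ^ (-s.re) ≤ Real.exp (2 * |Real.log c|) * N ^ (-(1 - ρ)) := by
    rw [Real.mul_rpow hc.le hN.le]
    refine mul_le_mul ?_ (Real.rpow_le_rpow_of_exponent_le (by linarith) (by linarith))
      (by positivity) (by positivity)
    rw [Real.rpow_def_of_pos hc, Real.exp_le_exp]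
    calc Real.log c * -s.re ≤ |Real.log c * -s.re| := le_abs_self _
      _ = |Real.log c| * s.re := by
        rw [abs_mul, abs_neg, abs_of_nonneg (by linarith : 0 ≤ s.re)]
      _ ≤ 2 * |Real.log c| := by nlinarith [abs_nonneg (Real.log c)]
  have hinv : ‖(1 - (primeNorm p.1 : ℂ) ^ (-s))⁻¹‖ ≤ 2 := by
    rw [norm_inv, inv_le_comm₀ (norm_pos_iff.2
      (one_sub_primeNorm_cpow_ne_zero p.1 (by linarith))) (by norm_num)]
    have h1 := norm_sub_norm_le (1 : ℂ) ((primeNorm p.1 : ℂ) ^ (-s))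
    rw [norm_one, norm_natCast_cpow_neg (primeNorm_pos p.1)] at h1
    have h2 : N ^ (-s.re) ≤ 1 / 2 := by
      calc N ^ (-s.re) ≤ N ^ (-(1 / 2) : ℝ) :=
            Real.rpow_le_rpow_of_exponent_le (by linarith) (by linarith)
        _ ≤ 4 ^ (-(1 / 2) : ℝ) :=
            Real.rpow_le_rpow_of_nonpos (by norm_num) hp4 (by norm_num)
        _ = 1 / 2 := by
            rw [show (4 : ℝ) = 2 ^ (2 : ℝ) by norm_num, ← Real.rpow_mul (by norm_num)]
            norm_num
    linarith
  have hlogN : 0 ≤ Real.log N := log_primeNorm_nonneg p.1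
  have hMc : 0 ≤ M / c * N ^ (-δ) := mul_nonneg (div_nonneg (hM p) hc.le) (by positivity)
  rw [comparisonTerm, norm_mul, norm_mul, Complex.norm_real, Real.norm_of_nonneg hlogN]
  calc Real.log N * ‖(((f p : ℕ) : ℝ) : ℂ) ^ (-s) - ((c * N : ℝ) : ℂ) ^ (-s)‖ *
        ‖(1 - (primeNorm p.1 : ℂ) ^ (-s))⁻¹‖
      ≤ Real.log N * (2 * (4 * (M / c * N ^ (-δ))) *
          (Real.exp (2 * |Real.log c|) * N ^ (-(1 - ρ)))) * 2 := by
        refine mul_le_mul (mul_le_mul_of_nonneg_left (hdif.trans ?_) hlogN) hinv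
          (norm_nonneg _) (by positivity)
        exact mul_le_mul (by linarith) hcpow (by positivity) (by positivity)
    _ = 16 * (M / c) * Real.exp (2 * |Real.log c|) *
          (Real.log N * (N ^ (-(1 - ρ)) * N ^ (-δ))) := by ring
    _ = _ := by
        rw [← Real.rpow_add hN]
        congr 3
        ring

/-- The sum over the primes outside `S` in terms of the sum over all primes. -/
theorem tsum_primesOutside_eq (hc : 0 < c) {b : ℝ} (hb : 0 < b)
    (h : ∀ p : PrimesOutside S, b * primeNorm p.1 ≤ (f p : ℕ)) {s : ℂ} (hs : 1 < s.re) :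
    ∑' b : PrimesOutside S × ℕ, (Real.log (primeNorm b.1.1) : ℂ) *
        (((f b.1 : ℕ) * primeNorm b.1.1 ^ b.2 : ℕ) : ℂ) ^ (-s) =
      (c : ℂ) ^ (-s) * (primeSum K s - ∑ p ∈ S, (Real.log (primeNorm p) : ℂ) *
        (primeNorm p : ℂ) ^ (-s) * (1 - (primeNorm p : ℂ) ^ (-s))⁻¹) +
      ∑' p, comparisonTerm f c p s := by
  have h1 := (summable_prime_power_sum (π := fun p : PrimesOutside S => p.1)
    Subtype.val_injective (F := fun p => (f p : ℕ)) hb h hs).2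
  have h2 := summable_primeSum (K := K) hs
  have h3 := h2.sum_add_tsum_subtype_compl S
  have h4 := (h2.subtype {p | p ∉ S}).hasSum.mul_left ((c : ℂ) ^ (-s))
  have h5 : ∀ p : PrimesOutside S, comparisonTerm f c p s =
      (Real.log (primeNorm p.1) : ℂ) * ((f p : ℕ) : ℂ) ^ (-s) *
        (1 - (primeNorm p.1 : ℂ) ^ (-s))⁻¹ - (c : ℂ) ^ (-s) * ((Real.log (primeNorm p.1) : ℂ) *
      (primeNorm p.1 : ℂ) ^ (-s) * (1 - (primeNorm p.1 : ℂ) ^ (-s))⁻¹) := by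
    intro p
    rw [comparisonTerm, Complex.ofReal_mul, Complex.mul_cpow_ofReal_nonneg hc.le
      (Nat.cast_nonneg _), Complex.ofReal_natCast, Complex.ofReal_natCast]
    ring
  have h6 : ∑' p, comparisonTerm f c p s = _ :=
    (tsum_congr h5).trans (h1.sub h4).tsum_eq
  rw [h6, primeSum, ← h3]
  change _ = _ * (_ + ∑' p : {p // p ∉ S}, _ - _) + (_ - _ * ∑' p : {p // p ∉ S}, _)
  simp only [Function.comp_apply]
  ring

end

end LegendreFactorial

end

/-! ### The double pole and the final theorem -/

noncomputable section

namespace LegendreFactorial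

open scoped Classical

variable {K : Type*} [Field K] [NumberField K] {S : Finset (HeightOneSpectrum (𝓞 K))}

/-- The Dirichlet series converges absolutely for `Re s > 1`, and up to an analytic factor it is
`(s - 1) ^ (-2)` near `1`. -/
theorem exists_analyticAt_dirichletSeries {f : PrimesOutside S → ℕ+} {c δ M : ℝ} (hc : 0 < c)
    (hδ : 0 < δ) (hf : ∀ p : PrimesOutside S, |((f p : ℕ) : ℝ) - c * (primeNorm p.1 : ℝ)| ≤
      M * (primeNorm p.1 : ℝ) ^ (1 - δ)) :
    (∀ s : ℂ, 1 < s.re → LSeriesSummable (coeff f) s) ∧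
    ∃ Q : ℂ → ℂ, AnalyticAt ℂ Q 1 ∧ Q 1 = 1 / c ∧
      ∀ᶠ s in 𝓝 (1 : ℂ), 1 < s.re → (s - 1) ^ 2 * dirichletSeries f s = Q s := by
  obtain ⟨b, hb, hbf⟩ := exists_mul_primeNorm_le ⟨c / 2, half_pos hc,
    (eventually_abs_log_le hc hδ hf).mono fun _ h => h.1⟩
  have hD : ∀ s : ℂ, 1 < s.re → _ := fun s hs =>
    dirichletSeries_eq f (finite_setOf_le hb hbf) hs
      (summable_prime_power_sum (π := fun p : PrimesOutside S => p.1)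
        Subtype.val_injective (F := fun p => (f p : ℕ)) hb hbf hs).1
  refine ⟨fun s hs => (hD s hs).1, ?_⟩
  obtain ⟨P, hP, hP1, hPs⟩ := exists_analyticAt_primeSum K
  obtain ⟨Z, hZ, hZ1, hZs⟩ := exists_analyticAt_riemannZeta
  let T : ℂ → ℂ := fun s => ∑ p ∈ S, (Real.log (primeNorm p) : ℂ) *
        (primeNorm p : ℂ) ^ (-s) * (1 - (primeNorm p : ℂ) ^ (-s))⁻¹
  let E : ℂ → ℂ := fun s => ∑' p, comparisonTerm f c p s
  have hE : AnalyticAt ℂ E 1 := analyticAt_tsum_comparisonTerm hc hδ hf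
  have hc0 : (c : ℂ) ≠ 0 := by exact_mod_cast hc.ne'
  have hC : AnalyticAt ℂ (fun s : ℂ => (c : ℂ) ^ (-s)) 1 :=
    (show Differentiable ℂ fun s : ℂ => (c : ℂ) ^ (-s) from
      differentiableAt_cpow_neg hc0).analyticAt 1
  have hT : AnalyticAt ℂ T 1 := by
    have hU : IsOpen {s : ℂ | 0 < s.re} := isOpen_lt continuous_const Complex.continuous_re
    refine DifferentiableOn.analyticAt (s := {s : ℂ | 0 < s.re}) (fun s hs => ?_)
      (hU.mem_nhds (by simp))
    refine (DifferentiableAt.fun_sum fun p _ => ?_).differentiableWithinAt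
    exact ((differentiableAt_cpow_neg (by exact_mod_cast (primeNorm_pos p).ne') s).const_mul
      _).mul (differentiableAt_primeFactor p hs)
  -- One factor `s - 1` goes to `ζ` and the other to the sum over primes. At 1 the terms with `T`
  -- and `E` vanish, leaving `c⁻¹`.
  refine ⟨fun s => Z s * ((c : ℂ) ^ (-s) * (P s - (s - 1) * T s) + (s - 1) * E s), ?_, ?_, ?_⟩
  · have h1 : AnalyticAt ℂ (fun s : ℂ => s - 1) 1 := analyticAt_id.sub analyticAt_const
    exact hZ.mul ((hC.mul (hP.sub (h1.mul hT))).add (h1.mul hE))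
  · simp [hZ1, hP1, Complex.cpow_neg_one]
  · filter_upwards [hPs] with s hPs hs
    have hs1 : s ≠ 1 := by rintro rfl; simp at hs
    rw [(hD s hs).2, tsum_primesOutside_eq hc hb hbf hs, ← hPs hs, hZs s hs1]
    ring

end LegendreFactorial

end

theorem proposition6p2 {K : Type*} [Field K] [NumberField K]
    (S : Finset (HeightOneSpectrum (𝓞 K)))
    (f : LegendreFactorial.PrimesOutside S → ℕ+)
    (c δ : ℝ) (hc : 0 < c) (hδ : 0 < δ)
    (hf : ∃ M : ℝ, ∀ p : LegendreFactorial.PrimesOutside S,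
      |((f p : ℕ) : ℝ) - c * (LegendreFactorial.primeNorm p.1 : ℝ)| ≤
        M * (LegendreFactorial.primeNorm p.1 : ℝ) ^ (1 - δ)) :
    -- the Dirichlet series converges absolutely for `Re s > 1`
    (∀ s : ℂ, 1 < s.re → LSeriesSummable (LegendreFactorial.coeff f) s) ∧
    -- it has a meromorphic continuation to a neighbourhood of `s = 1`
    (∃ F : ℂ → ℂ, LegendreFactorial.IsMeromorphicContinuationAtOne
      (LegendreFactorial.dirichletSeries f) F) ∧
    -- which has the stated pole, Laurent expansion and residues
    ∃ A : ℝ, ∀ F : ℂ → ℂ, LegendreFactorial.IsMeromorphicContinuationAtOne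
        (LegendreFactorial.dirichletSeries f) F →
      meromorphicOrderAt F 1 = ((-2 : ℤ) : WithTop ℤ) ∧
      (fun s : ℂ => F s - ((1 / (c : ℂ)) / (s - 1) ^ 2 + (A : ℂ) / (s - 1)))
        =O[𝓝[≠] (1 : ℂ)] (fun _ : ℂ => (1 : ℝ)) ∧
      ∀ x : ℝ, 0 < x →
        LegendreFactorial.HasResidueAt (fun s : ℂ => F s * ((x : ℂ) ^ s / s)) 1
          (((1 / c) * (x * Real.log x) + (A - 1 / c) * x : ℝ) : ℂ) := by
  obtain ⟨M, hf⟩ := hf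
  obtain ⟨hsum, Q, hQ, hQ1, hD⟩ :=
    LegendreFactorial.exists_analyticAt_dirichletSeries hc hδ hf
  exact ⟨hsum, LegendreFactorial.exists_isMeromorphicContinuationAtOne hQ hD,
    LegendreFactorial.polar_part_of_double_pole hc hQ hQ1 hD fun t _ =>
      LegendreFactorial.im_dirichletSeries f t⟩
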